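/- **Setting.** Parameters are real sequences $\theta=(\theta_1,\theta_2,\dots)$. For $k=0,1,2,\dots$ let $\boldsymbol\theta_k=(\theta_{2^k+l})_{0\le l<2^k}$ be the $k$-th dyadic block. For $\alpha>0$, $p\in[2,\infty]$, $q\in[1,\infty]$, $Q>0$ and $s=\alpha+\frac12-\frac1p$ (with $1/\infty=0$), the Besov ball is $$B^{\alpha}_{p,q}(Q)=\Big\{\theta:\ \sum_{k\ge0}2^{skq}\|\boldsymbol\theta_k\|_p^q\le Q^q\Big\},$$ read as $\{\theta:\sup_k 2^{sk}\|\boldsymbol\theta_k\|_p\le Q\}$ when $q=\infty$, where $\|\cdot\|_p$ is the vector $\ell^p$ norm. *Gaussian sequence model.* Given $\theta$, the observations are $X_i=\theta_i+n^{-1/2}Z_i$, $i=1,2,\dots$, with $Z_i$ i.i.d. standard normal; that is, $X=(X_1,X_2,\dots)\sim P^{(n)}_\theta=\bigotimes_{i\ge1}N(\theta_i,n^{-1})$. *Dyadic block prior.* For $k\ge0$ put $T_k=2\cdot2^{k^2}-2\cdot2^{-2^k+k^2-k}+2^{-2^k}$ and let $g_k$ be the probability density $$g_k(t)=\begin{cases}2^{k^2}\big(2^{-2^k}-T_k\big)t+T_k,&0\le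 t\le2^{-k^2},\\ 2^{-2^k},&2^{-k^2}<t\le2^{-k},\\0,&\text{otherwise.}\end{cases}$$ The prior $\bar\Pi$ is the law of $\theta$ obtained by drawing $A_k\sim g_k$ independently over $k$ and then, given $(A_k)_k$, drawing $\boldsymbol\theta_k\sim N(0,A_kI_{2^k})$ independently over $k$. It depends on none of $n,\alpha,p,q,Q$. Its posterior is $$\bar\Pi(S\mid X)=\frac{\int_S p^{(n)}_\theta(X)\,d\bar\Pi(\theta)}{\int p^{(n)}_\theta(X)\,d\bar\Pi(\theta)},$$ where $p^{(n)}_\theta$ is a jointly measurable version of the density of $P^{(n)}_\theta$ with respect to $P^{(n)}_0$ (which exists for $\theta\in\ell^2$, hence for $\bar\Pi$-almost every $\theta$; the density is taken to be that of the absolutely continuous part of $P^{(n)}_\theta$ elsewhere). **Theorem.** For every $\alpha>0$, $p\in[2,\infty]$, $q\in[1,\infty]$ and $Q>0$ there exists a constant $M>0$ such that $$\sup_{\theta_0\in B^{\alpha}_{p,q}(Q)}P^{(n)}_{\theta_0}\,\bar\Pi\Big(\|\theta-\theta_0\|_{\ell^2}>M\,n^{-\frac{\alpha}{2\alpha+1}}\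 \Big|\ X_1,X_2,\dots\Big)\longrightarrow0\qquad(n\to\infty),$$ where $P^{(n)}_{\theta_0}$ in front denotes expectation under $X\sim P^{(n)}_{\theta_0}$. -/

import Mathlib

open MeasureTheory ProbabilityTheory Filter Topology
open scoped ENNReal NNReal

namespace BlockPrior

noncomputable section

/-! ### Sequences, dyadic blocks and Besov balls

Parameters and observations are real sequences indexed by `{1, 2, 3, ...} = ℕ+`. -/

/-- The dyadic block at resolution level `k`, the vector `(θ_{2^k + l})_{0 ≤ l < 2^k}`. -/
def block (θ : ℕ+ → ℝ) (k : ℕ) : Fin (2 ^ k) → ℝ :=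
  fun l => θ ⟨2 ^ k + (l : ℕ), Nat.add_pos_left (pow_pos two_pos k) _⟩

/-- The weighted level norm `2^{s k} ‖θ_k‖_p` with `s = α + 1/2 - 1/p` (and `1/∞ = 0`), where
`‖·‖_p` is the vector `ℓ^p` norm. -/
def besovLevel (α : ℝ) (p : ℝ≥0∞) (θ : ℕ+ → ℝ) (k : ℕ) : ℝ :=
  (2 : ℝ) ^ ((α + 1 / 2 - (p⁻¹).toReal) * (k : ℝ)) * ‖WithLp.toLp p (block θ k)‖

/-- The Besov ball `B^α_{p,q}(Q)`: `∑_k 2^{s k q} ‖θ_k‖_p^q ≤ Q^q`, read as a supremum over `k`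
when `q = ∞`. The sum is taken in `[0, ∞]`. -/
def besovBall (α : ℝ) (p q : ℝ≥0∞) (Q : ℝ) : Set (ℕ+ → ℝ) :=
  {θ | if q = ∞ then ∀ k : ℕ, besovLevel α p θ k ≤ Q
    else ∑' k : ℕ, ENNReal.ofReal (besovLevel α p θ k) ^ q.toReal ≤ ENNReal.ofReal Q ^ q.toReal}

/-- The `ℓ²` distance between two sequences, with value `∞` if the difference is not in `ℓ²`. -/
def l2dist (θ θ' : ℕ+ → ℝ) : ℝ≥0∞ :=
  (∑' j, ENNReal.ofReal ((θ j - θ' j) ^ 2)) ^ (1 / 2 : ℝ)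

/-! ### Products of Gaussian measures depending on a parameter -/

/-- A product of one-dimensional Gaussian laws depends measurably on its parameters. -/
theorem measurable_infinitePi_gaussianReal {Ω : Type*} [MeasurableSpace Ω]
    {m : Ω → ℕ+ → ℝ} {v : Ω → ℕ+ → ℝ≥0} (hm : ∀ j, Measurable fun ω => m ω j)
    (hv : ∀ j, Measurable fun ω => v ω j) :
    Measurable fun ω => Measure.infinitePi fun j => gaussianReal (m ω j) (v ω j) := by
  refine Measurable.measure_of_isPiSystem_of_isProbabilityMeasure
    (S := squareCylinders fun _ : ℕ+ => {s : Set ℝ | MeasurableSet s})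
    generateFrom_squareCylinders.symm
    (isPiSystem_squareCylinders (fun _ => MeasurableSpace.isPiSystem_measurableSet)
      fun _ => by simp) ?_
  rintro _ ⟨s, t, ht, rfl⟩
  have ht' : ∀ j, MeasurableSet (t j) := fun j => ht j (Set.mem_univ j)
  simp_rw [Measure.infinitePi_pi _ fun j _ => ht' j]
  refine Finset.measurable_prod s fun j _ => ?_
  exact (Measure.measurable_coe (ht' j)).comp
    (measurable_gaussianReal.comp ((hm j).prodMk (hv j)))

/-! ### The Gaussian sequence model -/

/-- The Gaussian sequence model `P_θ^{(n)} = ⨂_{i ≥ 1} N(θ_i, 1/n)`, the law of the observations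
`X_i = θ_i + n^{-1/2} Z_i`. -/
def seqModel (n : ℕ) : Kernel (ℕ+ → ℝ) (ℕ+ → ℝ) where
  toFun θ := Measure.infinitePi fun i => gaussianReal (θ i) ((n : ℝ≥0)⁻¹)
  measurable' := measurable_infinitePi_gaussianReal (fun i => measurable_pi_apply i)
    fun _ => measurable_const

instance (n : ℕ) : IsMarkovKernel (seqModel n) :=
  ⟨fun θ => inferInstanceAs
    (IsProbabilityMeasure (Measure.infinitePi fun i => gaussianReal (θ i) ((n : ℝ≥0)⁻¹)))⟩

/-! ### The mixing densities -/

/-- `T_k = 2 · 2^{k²} - 2 · 2^{-2^k + k² - k} + 2^{-2^k}`. -/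
def mixT (k : ℕ) : ℝ :=
  2 * (2 : ℝ) ^ ((k : ℝ) ^ 2) - 2 * (2 : ℝ) ^ (-(2 : ℝ) ^ k + (k : ℝ) ^ 2 - k)
    + (2 : ℝ) ^ (-(2 : ℝ) ^ k)

/-- The mixing density `g_k`: affine from `T_k` to `2^{-2^k}` on `[0, 2^{-k²}]`, equal to
`2^{-2^k}` on `(2^{-k²}, 2^{-k}]`, and zero elsewhere. -/
def mixDensity (k : ℕ) (t : ℝ) : ℝ :=
  if t < 0 then 0
  else if t ≤ (2 : ℝ) ^ (-(k : ℝ) ^ 2) then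
    (2 : ℝ) ^ ((k : ℝ) ^ 2) * ((2 : ℝ) ^ (-(2 : ℝ) ^ k) - mixT k) * t + mixT k
  else if t ≤ (2 : ℝ) ^ (-(k : ℝ)) then (2 : ℝ) ^ (-(2 : ℝ) ^ k)
  else 0

/-- The law of the scale `A_k`. -/
def mixLaw (k : ℕ) : Measure ℝ :=
  volume.withDensity fun t => ENNReal.ofReal (mixDensity k t)

theorem mixT_pos (k : ℕ) : 0 < mixT k := by
  have h1 : (2 : ℝ) ^ (-(2 : ℝ) ^ k + (k : ℝ) ^ 2 - k) ≤ (2 : ℝ) ^ ((k : ℝ) ^ 2) := by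
    refine Real.rpow_le_rpow_of_exponent_le one_le_two ?_
    have h2 : (0 : ℝ) < (2 : ℝ) ^ k := by positivity
    have h3 : (0 : ℝ) ≤ (k : ℝ) := k.cast_nonneg
    linarith
  have h2 : (0 : ℝ) < (2 : ℝ) ^ (-(2 : ℝ) ^ k) := by positivity
  unfold mixT
  linarith

/-- The mixing density integrates to one. -/
instance (k : ℕ) : IsProbabilityMeasure (mixLaw k) := by
  constructor
  set b : ℝ := (2 : ℝ) ^ (-(k : ℝ) ^ 2) with hb
  set c : ℝ := (2 : ℝ) ^ (-(k : ℝ)) with hc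
  set u : ℝ := (2 : ℝ) ^ (-(2 : ℝ) ^ k) with hu
  set B : ℝ := (2 : ℝ) ^ ((k : ℝ) ^ 2) with hB
  have hb0 : 0 < b := by positivity
  have hu0 : 0 < u := by positivity
  have hBb : B * b = 1 := by
    rw [hB, hb, ← Real.rpow_add two_pos]; simp
  have hbc : b ≤ c := by
    refine Real.rpow_le_rpow_of_exponent_le one_le_two (neg_le_neg ?_)
    exact_mod_cast Nat.le_self_pow two_ne_zero k
  have hT : mixT k = 2 * B - 2 * (u * B * c) + u := by
    rw [mixT, hu, hB, hc, ← Real.rpow_add two_pos, ← Real.rpow_add two_pos, ← sub_eq_add_neg]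
  have hT0 := mixT_pos k
  have hsplit : ∀ t, ENNReal.ofReal (mixDensity k t) =
      (Set.Icc 0 b).indicator (fun t => ENNReal.ofReal (B * (u - mixT k) * t + mixT k)) t
        + (Set.Ioc b c).indicator (fun _ => ENNReal.ofReal u) t := by
    intro t
    unfold mixDensity
    rw [← hb, ← hc, ← hu, ← hB]
    by_cases h0 : t < 0
    · have h1 : t ∉ Set.Icc 0 b := fun h => absurd h.1 (not_le.2 h0)
      have h2 : t ∉ Set.Ioc b c := fun h => absurd (h0.trans hb0) (not_lt.2 h.1.le)
      simp [h0, h1, h2]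
    by_cases h1 : t ≤ b
    · have h2 : t ∈ Set.Icc 0 b := ⟨not_lt.1 h0, h1⟩
      have h3 : t ∉ Set.Ioc b c := fun h => absurd h.1 (not_lt.2 h1)
      simp [h0, h1, h2, h3]
    have h2 : t ∉ Set.Icc 0 b := fun h => h1 h.2
    by_cases h3 : t ≤ c
    · have h4 : t ∈ Set.Ioc b c := ⟨not_le.1 h1, h3⟩
      simp [h0, h1, h2, h3, h4]
    · have h4 : t ∉ Set.Ioc b c := fun h => h3 h.2
      simp [h0, h1, h2, h3, h4]
  have hint : ∫ t in Set.Icc 0 b, (B * (u - mixT k) * t + mixT k) = (u + mixT k) / 2 * b := by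
    rw [integral_Icc_eq_integral_Ioc, ← intervalIntegral.integral_of_le hb0.le,
      intervalIntegral.integral_add (Continuous.intervalIntegrable (by fun_prop) _ _)
        (Continuous.intervalIntegrable (by fun_prop) _ _),
      intervalIntegral.integral_const_mul, integral_id, intervalIntegral.integral_const]
    simp only [smul_eq_mul]
    linear_combination ((u - mixT k) * b / 2) * hBb
  have hlin : ∫⁻ t in Set.Icc 0 b, ENNReal.ofReal (B * (u - mixT k) * t + mixT k)
      = ENNReal.ofReal ((u + mixT k) / 2 * b) := by
    rw [← hint, ofReal_integral_eq_lintegral_ofReal]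
    · exact (Continuous.continuousOn (by fun_prop)).integrableOn_compact isCompact_Icc
    · refine (ae_restrict_iff' measurableSet_Icc).2 (ae_of_all _ fun t ht => ?_)
      have h1 : 0 ≤ B * t := by have := ht.1; positivity
      have h2 : B * t ≤ 1 := by
        rw [← hBb]; exact mul_le_mul_of_nonneg_left ht.2 (by positivity)
      change 0 ≤ B * (u - mixT k) * t + mixT k
      nlinarith [mul_nonneg h1 hu0.le, mul_nonneg (sub_nonneg.2 h2) hT0.le]
  rw [mixLaw, withDensity_apply _ MeasurableSet.univ, Measure.restrict_univ]
  simp_rw [hsplit]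
  rw [lintegral_add_right _ (measurable_const.indicator measurableSet_Ioc),
    lintegral_indicator measurableSet_Icc, lintegral_indicator measurableSet_Ioc, hlin,
    setLIntegral_const, Real.volume_Ioc, ← ENNReal.ofReal_mul hu0.le, ← ENNReal.ofReal_add
      (by positivity) (mul_nonneg hu0.le (sub_nonneg.2 hbc)), ENNReal.ofReal_eq_one, hT]
  linear_combination (1 - u * c) * hBb

/-! ### The block prior -/

/-- The conditional law of `θ` given the scales `A`: independently over the levels `k`, the block
`θ_k` has law `N(0, A_k I_{2^k})`. The coordinate `θ_j` lies in the block of level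
`⌊log₂ j⌋`. -/
def priorGivenScales : Kernel (ℕ → ℝ) (ℕ+ → ℝ) where
  toFun A := Measure.infinitePi fun j => gaussianReal 0 (A (Nat.log 2 (j : ℕ))).toNNReal
  measurable' := measurable_infinitePi_gaussianReal (fun _ => measurable_const)
    fun j => (measurable_pi_apply (Nat.log 2 (j : ℕ))).real_toNNReal

/-- The dyadic block prior: independent scales `A_k ∼ g_k`, and then `θ` drawn from its
conditional law given the scales. -/
def blockPrior : Measure (ℕ+ → ℝ) :=
  (Measure.infinitePi mixLaw).bind priorGivenScales

/-! ### The posterior distribution -/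

/-- The density `p_θ^{(n)}(x)` of the observations with respect to the dominating measure
`P_0^{(n)}` (pure noise), in a jointly measurable version. -/
def likelihood (n : ℕ) (θ x : ℕ+ → ℝ) : ℝ≥0∞ :=
  Kernel.rnDeriv (seqModel n) (Kernel.const _ (seqModel n 0)) θ x

/-- The posterior probability of `S` under the prior `ν`, given the observations `x`. -/
def posteriorProb (ν : Measure (ℕ+ → ℝ)) (n : ℕ) (x : ℕ+ → ℝ) (S : Set (ℕ+ → ℝ)) : ℝ≥0∞ :=
  (∫⁻ θ in S, likelihood n θ x ∂ν) / ∫⁻ θ, likelihood n θ x ∂ν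

end

end BlockPrior

/-! Let ε = n^(-α/(2α+1)) and choose K with 2^((2α+1)K) ≤ n ≤ 2^((2α+1)(K+1)). Then N = 2^K is of
the order of nε², and every estimate is made on the scale exp(-cN). Since p ≥ 2, membership in the
Besov ball is used only through ‖θ₀_k‖₂² ≤ Q² 2^(-2αk) (`sum_block_sq_le`), which makes all bounds
uniform in θ₀.

Prior mass. The density g_k is at least 2^(-2^k) on [0, 2^(-k)], so a scale of order 2^(-(2α+1)k),
the right one for smoothness α, is drawn for all k < K at a total cost of order ∑ 2^k ≤ N in the
exponent; no knowledge of α enters the prior. Given these scales, the coordinates below level K fall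
within n^(-1/2) of θ₀ at a further cost of order N. Above level K the scales are below 2^(-k²), up
to probability 2^(-2^k), and the coordinates are negligible. Hence a box B around θ₀ has mass at
least exp(-c₂N) (`le_blockPrior_paramBox`).

Sieve. The same double exponential tail puts all coordinates above level K+h under the radii
2^(-(2α+1)k/2), outside prior probability 24 exp(-2^(K+h)/2) (`blockPrior_sieve_compl_le`). A fixed
large h makes this smaller than any prescribed exp(-cN).

Test. Within the sieve, a θ far from θ₀ must differ from it in the first K+h blocks. One chi-square
test centred at θ₀ then detects it (`seqModel_acceptance_le`); as the truth is the centre, no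
covering argument is needed.

Evidence. For θ in B the bound P_θ₀(A)² ≤ exp(n‖θ-θ₀‖²) P_θ(A) replaces the usual Kullback-Leibler
control, and `lintegral_posterior_le` combines it with the test and the prior mass by Fubini and
Markov. -/

namespace BlockPrior

/-! ### Infinite product measures -/

section Product

variable {ι : Type*} {X : ι → Type*} {mX : ∀ i, MeasurableSpace (X i)}

theorem lintegral_finset_prod_infinitePi (μ : ∀ i, Measure (X i)) [∀ i, IsProbabilityMeasure (μ i)]
    (s : Finset ι) {f : ∀ i, X i → ℝ≥0∞} (hf : ∀ i, Measurable (f i)) :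
    ∫⁻ x, ∏ i ∈ s, f i (x i) ∂Measure.infinitePi μ = ∏ i ∈ s, ∫⁻ y, f i y ∂μ i := by
  rw [lintegral_prod_eq_prod_lintegral_of_indepFun s (fun i (x : ∀ i, X i) => f i (x i))
    (iIndepFun_infinitePi (P := μ) (X := f) hf)
    fun i => (hf i).comp (measurable_pi_apply i)]
  exact Finset.prod_congr rfl fun i _ =>
    (measurePreserving_eval_infinitePi μ i).lintegral_comp (hf i)

/-- Tilting finitely many factors of a product measure. -/
theorem infinitePi_withDensity_finset [DecidableEq ι] (ν : ∀ i, Measure (X i))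
    [∀ i, IsProbabilityMeasure (ν i)] {r : ∀ i, X i → ℝ≥0∞} (hr : ∀ i, Measurable (r i))
    [∀ i, IsProbabilityMeasure ((ν i).withDensity (r i))] (s : Finset ι) :
    (Measure.infinitePi ν).withDensity (fun x => ∏ i ∈ s, r i (x i)) =
      Measure.infinitePi fun i => (ν i).withDensity (if i ∈ s then r i else 1) := by
  have hi : ∀ i, IsProbabilityMeasure ((ν i).withDensity (if i ∈ s then r i else 1)) := by
    intro i
    split_ifs
    · infer_instance
    · rw [withDensity_one]; infer_instance
  refine Measure.eq_infinitePi _ fun u t ht => ?_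
  rw [withDensity_apply _ (MeasurableSet.pi u.countable_toSet fun i _ => ht i),
    ← lintegral_indicator (MeasurableSet.pi u.countable_toSet fun i _ => ht i)]
  -- Both the density and the indicator of the box are written as products over `s ∪ u`, so that the
  -- integrand factorises over coordinates.
  have h1 : ∀ x : ∀ i, X i, ((u : Set ι).pi t).indicator (fun x => ∏ i ∈ s, r i (x i)) x =
      ∏ i ∈ s ∪ u, (if i ∈ u then (t i).indicator 1 (x i) else 1) *
        (if i ∈ s then r i (x i) else 1) := by
    intro x
    have h2 : ∏ i ∈ s ∪ u, (if i ∈ s then r i (x i) else 1) = ∏ i ∈ s, r i (x i) := by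
      rw [Finset.prod_ite_mem, Finset.union_inter_cancel_left]
    have h3 : ∏ i ∈ s ∪ u, (if i ∈ u then (t i).indicator (1 : X i → ℝ≥0∞) (x i) else 1) =
        ∏ i ∈ u, (t i).indicator 1 (x i) := by
      rw [Finset.prod_ite_mem, Finset.union_inter_cancel_right]
    rw [Finset.prod_mul_distrib, h2, h3]
    by_cases hx : x ∈ (u : Set ι).pi t
    · rw [Set.indicator_of_mem hx, Finset.prod_congr rfl fun i hi =>
        Set.indicator_of_mem (hx i hi) _]
      simp
    · rw [Set.indicator_of_notMem hx]
      simp only [Set.mem_pi, not_forall] at hx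
      obtain ⟨i, hi, hx⟩ := hx
      rw [Finset.prod_eq_zero hi (Set.indicator_of_notMem hx _), zero_mul]
  simp_rw [h1]
  rw [lintegral_finset_prod_infinitePi ν (s ∪ u)
    (f := fun i y => (if i ∈ u then (t i).indicator 1 y else 1) * (if i ∈ s then r i y else 1))]
  · have h4 : ∀ i, (∫⁻ y, (if i ∈ u then (t i).indicator 1 y else 1) *
        (if i ∈ s then r i y else 1) ∂ν i) =
        if i ∈ u then (ν i).withDensity (if i ∈ s then r i else 1) (t i) else 1 := by
      intro i
      have h5 : ∀ y, (if i ∈ s then r i y else 1) = (if i ∈ s then r i else 1) y := by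
        intro y; split_ifs <;> rfl
      simp only [h5]
      by_cases h6 : i ∈ u
      all_goals simp only [h6, if_true, if_false]
      · rw [withDensity_apply _ (ht i), ← lintegral_indicator (ht i)]
        refine lintegral_congr fun y => ?_
        by_cases hy : y ∈ t i <;> simp [hy]
      · simp only [one_mul]
        rw [← setLIntegral_univ, ← withDensity_apply _ MeasurableSet.univ]
        exact (hi i).measure_univ
    simp_rw [h4]
    rw [Finset.prod_ite_mem, Finset.union_inter_cancel_right]
  · intro i
    refine Measurable.mul ?_ ?_
    · split_ifs
      · exact measurable_one.indicator (ht i)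
      · exact measurable_const
    · split_ifs
      · exact hr i
      · exact measurable_const

/-- The Cauchy-Schwarz bound of a measure given by a square integrable density. -/
theorem withDensity_apply_sq_le {Ω : Type*} {mΩ : MeasurableSpace Ω} (ν : Measure Ω)
    {r : Ω → ℝ≥0∞} (hr : Measurable r) {A : Set Ω} (hA : MeasurableSet A) :
    (ν.withDensity r A) ^ 2 ≤ (∫⁻ x, r x ^ 2 ∂ν) * ν A := by
  have h := ENNReal.lintegral_mul_le_Lp_mul_Lq ν Real.HolderConjugate.two_two
    hr.aemeasurable ((measurable_one (α := ℝ≥0∞)).indicator hA).aemeasurable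
  have h1 : ∫⁻ x, (r * A.indicator (1 : Ω → ℝ≥0∞)) x ∂ν = ν.withDensity r A := by
    rw [withDensity_apply _ hA, ← lintegral_indicator hA]
    refine lintegral_congr fun x => ?_
    by_cases hx : x ∈ A <;> simp [hx]
  have h2 : ∫⁻ x, (A.indicator (1 : Ω → ℝ≥0∞) x) ^ (2 : ℝ) ∂ν = ν A := by
    rw [← lintegral_indicator_one hA]
    refine lintegral_congr fun x => ?_
    by_cases hx : x ∈ A <;> simp [hx]
  rw [h1, h2] at h
  calc _ ≤ _ := pow_le_pow_left' h 2
    _ = _ := by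
      rw [mul_pow, ← ENNReal.rpow_natCast, ← ENNReal.rpow_natCast, ← ENNReal.rpow_mul,
        ← ENNReal.rpow_mul]
      simp

/-- Two product measures whose finite dimensional chi-square divergences are bounded. -/
theorem infinitePi_sq_le (μ ν : ∀ i, Measure (X i))
    [∀ i, IsProbabilityMeasure (μ i)] [∀ i, IsProbabilityMeasure (ν i)]
    {r : ∀ i, X i → ℝ≥0∞} (hr : ∀ i, Measurable (r i)) (hμ : ∀ i, μ i = (ν i).withDensity (r i))
    {C : ℝ≥0∞} (hC : C ≠ ∞) (hs : ∀ s : Finset ι, ∏ i ∈ s, ∫⁻ y, r i y ^ 2 ∂ν i ≤ C)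
    {A : Set (∀ i, X i)} (hA : MeasurableSet A) :
    (Measure.infinitePi μ A) ^ 2 ≤ C * Measure.infinitePi ν A := by
  classical
  have hprob : ∀ i, IsProbabilityMeasure ((ν i).withDensity (r i)) := fun i => by
    rw [← hμ]; infer_instance
  -- On a cylinder only finitely many factors matter, so the finite tilt and Cauchy-Schwarz suffice;
  -- no density of the full infinite product is constructed.
  have hcyl : ∀ t ∈ measurableCylinders X,
      (Measure.infinitePi μ t) ^ 2 ≤ C * Measure.infinitePi ν t := by
    intro t ht
    obtain ⟨s, S, hS, rfl⟩ := (mem_measurableCylinders t).1 ht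
    have hi : ∀ i, IsProbabilityMeasure ((ν i).withDensity (if i ∈ s then r i else 1)) := by
      intro i
      split_ifs
      · infer_instance
      · rw [withDensity_one]; infer_instance
    have h1 : Measure.infinitePi μ (cylinder s S) =
        (Measure.infinitePi ν).withDensity (fun x => ∏ i ∈ s, r i (x i)) (cylinder s S) := by
      rw [infinitePi_withDensity_finset ν hr s, Measure.infinitePi_cylinder _ hS,
        Measure.infinitePi_cylinder _ hS]
      congr 2
      ext1 i
      rw [hμ, if_pos i.2]
    rw [h1]
    refine (withDensity_apply_sq_le _ (by fun_prop) (hS.cylinder)).trans ?_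
    gcongr
    simp_rw [← Finset.prod_pow]
    rw [lintegral_finset_prod_infinitePi ν s (f := fun i y => r i y ^ 2)
      fun i => (hr i).pow_const 2]
    exact hs s
  set P := Measure.infinitePi μ
  set R := Measure.infinitePi ν
  have happrox : ∀ ε : ℝ≥0∞, 0 < ε → P A ≤ (C * (R A + ε)) ^ (2 : ℝ)⁻¹ + ε := by
    intro ε hε
    -- Approximation under the sum `P + R` gives one cylinder that is close to `A` for both
    -- measures.
    obtain ⟨t, ht, htA⟩ := exists_measure_symmDiff_lt_of_generateFrom_isSetRing (μ := P + R)
      isSetRing_measurableCylinders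
      ⟨{Set.univ}, Set.countable_singleton _, by simpa using univ_mem_measurableCylinders X, by simp⟩
      generateFrom_measurableCylinders.symm hA hε
    have hP : P (symmDiff t A) ≤ ε := by
      refine le_trans ?_ htA.le; rw [Measure.add_apply]; exact le_self_add
    have hR : R (symmDiff t A) ≤ ε := by
      refine le_trans ?_ htA.le; rw [Measure.add_apply]; exact le_add_self
    have h1 : P A ≤ P t + P (symmDiff t A) := by
      refine (measure_mono ?_).trans (measure_union_le _ _)
      intro x hx
      by_cases hxt : x ∈ t
      · exact Or.inl hxt
      · exact Or.inr (Or.inr ⟨hx, hxt⟩)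
    have h2 : R t ≤ R A + R (symmDiff t A) := by
      refine (measure_mono ?_).trans (measure_union_le _ _)
      intro x hx
      by_cases hxt : x ∈ A
      · exact Or.inl hxt
      · exact Or.inr (Or.inl ⟨hx, hxt⟩)
    have h3 : P t ≤ (C * (R A + ε)) ^ (2 : ℝ)⁻¹ := by
      rw [ENNReal.le_rpow_inv_iff two_pos]
      have := hcyl t ht
      calc P t ^ (2 : ℝ) = P t ^ 2 := by norm_cast
        _ ≤ C * R t := this
        _ ≤ _ := by gcongr; exact h2.trans (by gcongr)
    exact h1.trans (add_le_add h3 hP)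
  have hlim : Tendsto (fun ε : ℝ≥0∞ => (C * (R A + ε)) ^ (2 : ℝ)⁻¹ + ε) (𝓝[>] 0)
      (𝓝 ((C * (R A + 0)) ^ (2 : ℝ)⁻¹ + 0)) := by
    refine Tendsto.mono_left ?_ nhdsWithin_le_nhds
    refine Tendsto.add ?_ tendsto_id
    refine Tendsto.ennrpow_const _ (ENNReal.Tendsto.const_mul ?_ (Or.inr hC))
    exact tendsto_const_nhds.add tendsto_id
  have hle := ge_of_tendsto hlim (eventually_nhdsWithin_of_forall fun ε hε => happrox ε hε)
  rw [add_zero, add_zero, ENNReal.le_rpow_inv_iff two_pos] at hle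
  exact_mod_cast hle

/-- A lower bound of the measure of a box in a product space. -/
theorem exp_neg_tsum_le_infinitePi [Countable ι] (μ : ∀ i, Measure (X i))
    [∀ i, IsProbabilityMeasure (μ i)] {t : ∀ i, Set (X i)} (ht : ∀ i, MeasurableSet (t i))
    {b : ι → ℝ≥0∞} {c : ℝ} (hbc : ∑' i, b i ≤ ENNReal.ofReal c) (hc : 0 ≤ c)
    (hb : ∀ i, ENNReal.ofReal (Real.exp (-(b i).toReal)) ≤ μ i (t i)) :
    ENNReal.ofReal (Real.exp (-c)) ≤ Measure.infinitePi μ (Set.univ.pi t) := by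
  rw [Measure.infinitePi_pi_univ _ ht, ENNReal.tprod_eq_iInf_prod (by simp [prob_le_one])]
  refine le_iInf fun s => ?_
  refine le_trans ?_ (Finset.prod_le_prod' fun i _ => hb i)
  rw [← ENNReal.ofReal_prod_of_nonneg fun i _ => (Real.exp_pos _).le, ← Real.exp_sum]
  refine ENNReal.ofReal_le_ofReal (Real.exp_le_exp.2 ?_)
  rw [Finset.sum_neg_distrib, neg_le_neg_iff]
  have h1 : ∀ i, b i ≠ ∞ := fun i => ne_top_of_le_ne_top ENNReal.ofReal_ne_top
    ((ENNReal.le_tsum i).trans hbc)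
  rw [← ENNReal.toReal_sum fun i _ => h1 i]
  exact ENNReal.toReal_le_of_le_ofReal hc ((ENNReal.sum_le_tsum s).trans hbc)

end Product

/-! ### Posterior mass from prior mass, chi-square divergence and a test -/

section Bayes

variable {Θ X : Type*} [MeasurableSpace Θ] [MeasurableSpace X]
  [MeasurableSpace.CountableOrCountablyGenerated Θ X]

/-- If `P² ≤ C R` on all events, the event where the density of `P` is at least `t` times the
density of `R` has small `P`-probability. -/
theorem measure_le_div_of_sq_le {P R : Measure X} [IsFiniteMeasure P] {A : Set X} {C t : ℝ≥0∞}
    (ht : t ≠ 0) (ht' : t ≠ ∞) (hsq : P A ^ 2 ≤ C * R A) (hA : t * R A ≤ P A) : P A ≤ C / t := by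
  rw [ENNReal.le_div_iff_mul_le (Or.inl ht) (Or.inl ht')]
  by_cases h0 : P A = 0
  · simp [h0]
  have h1 : P A * t * P A ≤ C * P A := by
    calc P A * t * P A = t * P A ^ 2 := by ring
      _ ≤ t * (C * R A) := by gcongr
      _ = C * (t * R A) := by ring
      _ ≤ _ := by gcongr
  exact (ENNReal.mul_le_mul_iff_left h0 (measure_ne_top P A)).1 h1

/-- The posterior mass of `S`, in terms of a set `B` of parameters close to the truth `θ₀` in
chi-square divergence and of the acceptance region `E` of a test. -/
theorem lintegral_posterior_le (κ : Kernel Θ X) [IsMarkovKernel κ] (μ : Measure X)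
    [IsProbabilityMeasure μ] (ν : Measure Θ) [IsProbabilityMeasure ν] {θ₀ : Θ} (h0 : κ θ₀ ≪ μ)
    {B : Set Θ} (hB0 : ν B ≠ 0) (hBac : ∀ θ ∈ B, κ θ ≪ μ)
    {C : ℝ≥0∞} (hBC : ∀ θ ∈ B, ∀ A, MeasurableSet A → κ θ₀ A ^ 2 ≤ C * κ θ A)
    {E : Set X} (hE : MeasurableSet E) (S : Set Θ) {t : ℝ≥0∞} (ht : t ≠ 0) (ht' : t ≠ ∞) :
    ∫⁻ x, (∫⁻ θ in S, Kernel.rnDeriv κ (Kernel.const _ μ) θ x ∂ν) /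
        (∫⁻ θ, Kernel.rnDeriv κ (Kernel.const _ μ) θ x ∂ν) ∂κ θ₀ ≤
      κ θ₀ Eᶜ + 2 * (C / t) + 2 * t / ν B * ∫⁻ θ in S, κ θ E ∂ν := by
  set L : Θ → X → ℝ≥0∞ := fun θ x => Kernel.rnDeriv κ (Kernel.const _ μ) θ x with hL
  have hLm : Measurable fun z : Θ × X => L z.1 z.2 := Kernel.measurable_rnDeriv κ _
  have hL0 : Measurable (L θ₀) := hLm.comp measurable_prodMk_left
  have hLle : ∀ θ, ∀ A, MeasurableSet A → ∫⁻ x in A, L θ x ∂μ ≤ κ θ A := fun θ A hA =>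
    Kernel.setLIntegral_rnDeriv_le (η := Kernel.const _ μ) hA
  have hLeq : ∀ θ, κ θ ≪ μ → ∀ A, MeasurableSet A → ∫⁻ x in A, L θ x ∂μ = κ θ A :=
    fun θ h A hA => Kernel.setLIntegral_rnDeriv (η := Kernel.const _ μ) h hA
  set W : Set (X × Θ) := {z | t * L z.2 z.1 < L θ₀ z.1} with hW
  have hWm : MeasurableSet W := measurableSet_lt
    ((hLm.comp measurable_swap).const_mul t) (hL0.comp measurable_fst)
  have hWB : ∀ θ ∈ B, κ θ₀ {x | (x, θ) ∈ W} ≤ C / t := by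
    intro θ hθ
    have hm : MeasurableSet {x | (x, θ) ∈ W} := measurable_prodMk_right hWm
    refine measure_le_div_of_sq_le (R := κ θ) ht ht' (hBC θ hθ _ hm) ?_
    rw [← hLeq θ (hBac θ hθ) _ hm, ← hLeq θ₀ h0 _ hm,
      ← lintegral_const_mul _ (show Measurable (L θ) from hLm.comp measurable_prodMk_left)]
    refine setLIntegral_mono hL0 fun x hx => le_of_lt hx
  -- The prior mass of those θ in `B` whose likelihood falls short of that of θ₀ by more than the
  -- factor `t`. By Fubini its mean is at most `ν B * (C / t)`, so by Markov it stays below half of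
  -- `ν B` outside an event of probability `2 * (C / t)`.
  set w : X → ℝ≥0∞ := fun x => ν.restrict B {θ | (x, θ) ∈ W} with hw
  have hwm : Measurable w := measurable_measure_prodMk_left hWm
  set G : Set X := {x | w x < ν B / 2} with hG
  have hGm : MeasurableSet G := measurableSet_lt hwm measurable_const
  have hBtop : ν B ≠ ∞ := measure_ne_top ν B
  have hGc : κ θ₀ Gᶜ ≤ 2 * (C / t) := by
    have h1 : ν B / 2 * κ θ₀ Gᶜ ≤ ∫⁻ x, w x ∂κ θ₀ := by
      have : Gᶜ = {x | ν B / 2 ≤ w x} := by ext x; simp [hG]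
      rw [this]
      exact mul_meas_ge_le_lintegral hwm _
    have h2 : ∫⁻ x, w x ∂κ θ₀ ≤ ν B * (C / t) := by
      have h3 : ∫⁻ x, w x ∂κ θ₀ = ∫⁻ θ in B, κ θ₀ {x | (x, θ) ∈ W} ∂ν := by
        rw [hw]
        exact (Measure.prod_apply hWm).symm.trans (Measure.prod_apply_symm hWm)
      rw [h3]
      refine (setLIntegral_mono measurable_const hWB).trans ?_
      rw [setLIntegral_const, mul_comm]
    have h4 : ν B * κ θ₀ Gᶜ ≤ ν B * (2 * (C / t)) := by
      calc ν B * κ θ₀ Gᶜ = 2 * (ν B / 2 * κ θ₀ Gᶜ) := by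
            rw [← mul_assoc, ENNReal.mul_div_cancel two_ne_zero ENNReal.ofNat_ne_top]
        _ ≤ 2 * (ν B * (C / t)) := by exact mul_le_mul_right (h1.trans h2) _
        _ = _ := by ring
    exact (ENNReal.mul_le_mul_iff_right hB0 hBtop).1 h4
  set D : X → ℝ≥0∞ := fun x => ∫⁻ θ, L θ x ∂ν with hD
  set N : X → ℝ≥0∞ := fun x => ∫⁻ θ in S, L θ x ∂ν with hN
  have hNm : Measurable N :=
    Measurable.lintegral_prod_left' (μ := ν.restrict S) hLm
  have hDm : Measurable D := Measurable.lintegral_prod_left' (μ := ν) hLm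
  -- On `G` at least half of `B` has likelihood at least `L θ₀ x / t`, which bounds the evidence
  -- from below.
  have hDG : ∀ x ∈ G, ν B / 2 * L θ₀ x ≤ t * D x := by
    intro x hx
    have hms : MeasurableSet {θ | (x, θ) ∈ W} := measurable_prodMk_left hWm
    have h1 : ν B / 2 ≤ ν.restrict B {θ | (x, θ) ∈ W}ᶜ := by
      have h2 : ν.restrict B {θ | (x, θ) ∈ W} + ν.restrict B {θ | (x, θ) ∈ W}ᶜ = ν B := by
        rw [measure_add_measure_compl hms, Measure.restrict_apply_univ]
      by_contra! h3
      have : ν B < ν B / 2 + ν B / 2 := by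
        rw [← h2]
        conv_rhs => rw [h2]
        exact ENNReal.add_lt_add hx h3
      rw [ENNReal.add_halves] at this
      exact lt_irrefl _ this
    calc ν B / 2 * L θ₀ x ≤ ν.restrict B {θ | (x, θ) ∈ W}ᶜ * L θ₀ x := by gcongr
      _ = ∫⁻ θ in {θ | (x, θ) ∈ W}ᶜ, L θ₀ x ∂(ν.restrict B) := by
        rw [setLIntegral_const, mul_comm]
      _ ≤ ∫⁻ θ in {θ | (x, θ) ∈ W}ᶜ, t * L θ x ∂(ν.restrict B) := by
        refine setLIntegral_mono ((hLm.comp measurable_prodMk_right).const_mul t) fun θ hθ => ?_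
        exact not_lt.1 hθ
      _ ≤ ∫⁻ θ, t * L θ x ∂ν := by
        refine lintegral_mono' (Measure.restrict_le_self.trans Measure.restrict_le_self) le_rfl
      _ = t * D x := lintegral_const_mul _ (hLm.comp measurable_prodMk_right)
  -- The conventions 0/0 = 0 and ∞/∞ = 0 in `ℝ≥0∞` cover degenerate evidence, so its positivity and
  -- finiteness need no proof.
  have hle1 : ∀ x, N x / D x ≤ 1 := fun x => by
    refine ENNReal.div_le_of_le_mul ?_
    rw [one_mul]
    exact lintegral_mono' Measure.restrict_le_self le_rfl
  have hpt : ∀ x ∈ G, L θ₀ x * (N x / D x) ≤ 2 * t / ν B * N x := by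
    intro x hx
    have h1 : L θ₀ x ≤ 2 * t / ν B * D x := by
      have := hDG x hx
      calc L θ₀ x = 2 / ν B * (ν B / 2 * L θ₀ x) := by
            rw [← mul_assoc, ← mul_div_assoc, ENNReal.div_mul_cancel hB0 hBtop,
              ENNReal.div_self two_ne_zero ENNReal.ofNat_ne_top, one_mul]
        _ ≤ 2 / ν B * (t * D x) := by gcongr
        _ = _ := by rw [ENNReal.mul_div_right_comm]; ring
    calc L θ₀ x * (N x / D x) ≤ 2 * t / ν B * D x * (N x / D x) := by gcongr
      _ = 2 * t / ν B * (D x * (N x / D x)) := by ring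
      _ ≤ _ := by gcongr; exact ENNReal.mul_div_le
  have hEG : ∫⁻ x in E ∩ G, N x / D x ∂κ θ₀ ≤ 2 * t / ν B * ∫⁻ θ in S, κ θ E ∂ν := by
    have hκ : κ θ₀ = μ.withDensity (L θ₀) := by
      ext A hA
      rw [withDensity_apply _ hA, hLeq θ₀ h0 A hA]
    rw [hκ, show (∫⁻ x in E ∩ G, N x / D x ∂μ.withDensity (L θ₀)) =
      ∫⁻ x in E ∩ G, L θ₀ x * (N x / D x) ∂μ from
      setLIntegral_withDensity_eq_setLIntegral_mul _ hL0 (hNm.div hDm) (hE.inter hGm)]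
    calc _ ≤ ∫⁻ x in E ∩ G, 2 * t / ν B * N x ∂μ :=
          setLIntegral_mono (hNm.const_mul _) fun x hx => hpt x hx.2
      _ ≤ ∫⁻ x in E, 2 * t / ν B * N x ∂μ := lintegral_mono_set Set.inter_subset_left
      _ = 2 * t / ν B * ∫⁻ x in E, N x ∂μ := lintegral_const_mul _ hNm
      _ = 2 * t / ν B * ∫⁻ θ in S, ∫⁻ x in E, L θ x ∂μ ∂ν := by
        congr 1
        exact lintegral_lintegral_swap (hLm.comp measurable_swap).aemeasurable
      -- For θ in `S` only an inequality is available, and it is enough: `κ θ` may have a singular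
      -- part.
      _ ≤ _ := by gcongr with θ; exact hLle θ E hE
  calc ∫⁻ x, N x / D x ∂κ θ₀
      = ∫⁻ x in E ∩ G, N x / D x ∂κ θ₀ + ∫⁻ x in (E ∩ G)ᶜ, N x / D x ∂κ θ₀ :=
        (lintegral_add_compl _ (hE.inter hGm)).symm
    _ ≤ 2 * t / ν B * ∫⁻ θ in S, κ θ E ∂ν + (κ θ₀ Eᶜ + 2 * (C / t)) := by
        refine add_le_add hEG ?_
        calc _ ≤ ∫⁻ x in (E ∩ G)ᶜ, 1 ∂κ θ₀ := lintegral_mono hle1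
          _ = κ θ₀ (E ∩ G)ᶜ := setLIntegral_one _
          _ ≤ κ θ₀ Eᶜ + κ θ₀ Gᶜ := by rw [Set.compl_inter]; exact measure_union_le _ _
          _ ≤ _ := by gcongr
    _ = _ := add_comm _ _

end Bayes

/-! ### One-dimensional Gaussian estimates -/

section Gaussian

/-- The likelihood ratio of `N(m', v)` with respect to `N(m, v)`. -/
noncomputable def gaussianRatio (m m' : ℝ) (v : ℝ≥0) (x : ℝ) : ℝ≥0∞ :=
  ENNReal.ofReal (Real.exp (((m' - m) * (x - m) - (m' - m) ^ 2 / 2) / v))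

theorem measurable_gaussianRatio (m m' : ℝ) (v : ℝ≥0) : Measurable (gaussianRatio m m' v) := by
  unfold gaussianRatio; fun_prop

theorem gaussianReal_eq_withDensity (m m' : ℝ) {v : ℝ≥0} (hv : v ≠ 0) :
    gaussianReal m' v = (gaussianReal m v).withDensity (gaussianRatio m m' v) := by
  rw [gaussianReal_of_var_ne_zero m hv, gaussianReal_of_var_ne_zero m' hv,
    ← withDensity_mul _ (measurable_gaussianPDF m v) (measurable_gaussianRatio m m' v)]
  congr 1
  ext1 x
  have hv' : (v : ℝ) ≠ 0 := NNReal.coe_ne_zero.2 hv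
  simp only [Pi.mul_apply, gaussianPDF, gaussianRatio]
  rw [← ENNReal.ofReal_mul (gaussianPDFReal_nonneg _ _ _), gaussianPDFReal, gaussianPDFReal,
    mul_assoc (Real.sqrt _)⁻¹, ← Real.exp_add]
  congr 3
  field_simp
  ring

/-- The square of the ratio for a shift by `m' - m` is a constant times the ratio for twice that
shift, and the latter integrates to one. -/
theorem lintegral_gaussianRatio_sq (m m' : ℝ) {v : ℝ≥0} (hv : v ≠ 0) :
    ∫⁻ x, gaussianRatio m m' v x ^ 2 ∂gaussianReal m v =
      ENNReal.ofReal (Real.exp ((m' - m) ^ 2 / v)) := by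
  have hv' : (v : ℝ) ≠ 0 := NNReal.coe_ne_zero.2 hv
  have h1 : ∀ x, gaussianRatio m m' v x ^ 2 =
      ENNReal.ofReal (Real.exp ((m' - m) ^ 2 / v)) * gaussianRatio m (m + 2 * (m' - m)) v x := by
    intro x
    rw [gaussianRatio, gaussianRatio, ← ENNReal.ofReal_pow (Real.exp_pos _).le, ← Real.exp_nat_mul,
      ← ENNReal.ofReal_mul (Real.exp_pos _).le, ← Real.exp_add]
    congr 2
    push_cast
    field_simp
    ring
  simp_rw [h1]
  rw [lintegral_const_mul _ (measurable_gaussianRatio _ _ _), ← setLIntegral_univ,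
    ← withDensity_apply _ MeasurableSet.univ, ← gaussianReal_eq_withDensity _ _ hv, measure_univ,
    mul_one]

/-- The exponential weight halves the precision: up to the factor √2 it turns the density of
variance `v` into that of variance `2 * v`. -/
theorem lintegral_exp_sq_gaussianReal (m : ℝ) {v : ℝ≥0} (hv : v ≠ 0) :
    ∫⁻ x, ENNReal.ofReal (Real.exp ((v : ℝ)⁻¹ * (x - m) ^ 2 / 4)) ∂gaussianReal m v =
      ENNReal.ofReal (Real.sqrt 2) := by
  have hv' : (v : ℝ) ≠ 0 := NNReal.coe_ne_zero.2 hv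
  rw [gaussianReal_of_var_ne_zero m hv, lintegral_withDensity_eq_lintegral_mul _
    (measurable_gaussianPDF m v) (by fun_prop)]
  have h1 : ∀ x, (gaussianPDF m v * fun x =>
      ENNReal.ofReal (Real.exp ((v : ℝ)⁻¹ * (x - m) ^ 2 / 4))) x =
      ENNReal.ofReal (Real.sqrt 2) * gaussianPDF m (2 * v) x := by
    intro x
    simp only [Pi.mul_apply, gaussianPDF]
    rw [← ENNReal.ofReal_mul (gaussianPDFReal_nonneg _ _ _),
      ← ENNReal.ofReal_mul (Real.sqrt_nonneg _), gaussianPDFReal, gaussianPDFReal, mul_assoc,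
      ← Real.exp_add]
    congr 1
    have h2 : Real.sqrt (2 * Real.pi * ((2 * v : ℝ≥0) : ℝ)) =
        Real.sqrt 2 * Real.sqrt (2 * Real.pi * v) := by
      rw [← Real.sqrt_mul zero_le_two]
      push_cast
      congr 1
      ring
    rw [h2, mul_inv, ← mul_assoc, ← mul_assoc, mul_inv_cancel₀ (by positivity), one_mul]
    congr 2
    push_cast
    field_simp
    ring
  simp_rw [h1]
  rw [lintegral_const_mul _ (measurable_gaussianPDF _ _),
    lintegral_gaussianPDF_eq_one _ (mul_ne_zero two_ne_zero hv), mul_one]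

/-- Chernoff bound with parameter `r / a` instead of `r / v`, so that the degenerate case `v = 0` is
included. -/
theorem gaussianReal_abs_gt_le {v : ℝ≥0} {a r : ℝ} (ha : 0 < a) (hva : (v : ℝ) ≤ a) (hr : 0 ≤ r) :
    gaussianReal 0 v {x | r < |x|} ≤ ENNReal.ofReal (2 * Real.exp (-(r ^ 2 / (2 * a)))) := by
  have hb : Real.exp (-(r / a) * r + v * (r / a) ^ 2 / 2) ≤ Real.exp (-(r ^ 2 / (2 * a))) := by
    refine Real.exp_le_exp.2 ?_
    have h1 : (v : ℝ) * (r / a) ^ 2 ≤ a * (r / a) ^ 2 := by gcongr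
    have h2 : a * (r / a) ^ 2 = r ^ 2 / a := by field_simp
    have h3 : r / a * r = r ^ 2 / a := by ring
    have h4 : r ^ 2 / (2 * a) = r ^ 2 / a / 2 := by field_simp
    rw [h4]
    nlinarith
  have h1 : (gaussianReal 0 v).real {x | r ≤ id x} ≤ Real.exp (-(r ^ 2 / (2 * a))) := by
    refine (measure_ge_le_exp_mul_mgf (t := r / a) r (by positivity)
      (integrable_exp_mul_gaussianReal _)).trans ?_
    rw [mgf_fun_id_gaussianReal, ← Real.exp_add]
    refine le_trans (le_of_eq ?_) hb
    congr 1
    ring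
  have h2 : (gaussianReal 0 v).real {x | id x ≤ -r} ≤ Real.exp (-(r ^ 2 / (2 * a))) := by
    refine (measure_le_le_exp_mul_mgf (t := -(r / a)) (-r) (by
      have : 0 ≤ r / a := by positivity
      linarith) (integrable_exp_mul_gaussianReal _)).trans ?_
    rw [mgf_fun_id_gaussianReal, ← Real.exp_add]
    refine le_trans (le_of_eq ?_) hb
    congr 1
    ring
  have h3 : (gaussianReal 0 v).real {x | r < |x|} ≤ 2 * Real.exp (-(r ^ 2 / (2 * a))) := by
    rw [two_mul]
    refine le_trans (measureReal_mono (s₂ := {x | r ≤ id x} ∪ {x | id x ≤ -r}) ?_)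
      ((measureReal_union_le _ _).trans (add_le_add h1 h2))
    intro x hx
    rcases lt_abs.1 (show r < |x| from hx) with h | h
    · exact Or.inl h.le
    · exact Or.inr (by simp only [Set.mem_ofPred_eq, id]; linarith)
  rw [← ofReal_measureReal]
  exact ENNReal.ofReal_le_ofReal h3

/-- Length of the interval times a lower bound of the density on it: `v ≤ a` controls the
normalisation and `a / 2 ≤ v` the exponent. -/
theorem le_gaussianReal_Icc {v : ℝ≥0} {a m δ : ℝ} (ha : 0 < a) (hva : (v : ℝ) ≤ a)
    (hav : a / 2 ≤ v) :
    ENNReal.ofReal (2 * δ / Real.sqrt (2 * Real.pi * a) * Real.exp (-(2 * (m ^ 2 + δ ^ 2) / a))) ≤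
      gaussianReal 0 v (Set.Icc (m - δ) (m + δ)) := by
  have hv : 0 < (v : ℝ) := by linarith
  rcases le_or_gt δ 0 with hδ | hδ
  · rw [ENNReal.ofReal_of_nonpos]
    · exact zero_le
    · refine mul_nonpos_of_nonpos_of_nonneg (div_nonpos_of_nonpos_of_nonneg (by linarith)
        (by positivity)) (by positivity)
  rw [gaussianReal_apply _ (NNReal.coe_ne_zero.1 hv.ne')]
  have h1 : ENNReal.ofReal (2 * δ / Real.sqrt (2 * Real.pi * a) *
        Real.exp (-(2 * (m ^ 2 + δ ^ 2) / a))) =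
      ∫⁻ _ in Set.Icc (m - δ) (m + δ), ENNReal.ofReal ((Real.sqrt (2 * Real.pi * a))⁻¹ *
        Real.exp (-(2 * (m ^ 2 + δ ^ 2) / a))) := by
    rw [setLIntegral_const, Real.volume_Icc, ← ENNReal.ofReal_mul (by positivity)]
    congr 1
    ring
  rw [h1]
  refine setLIntegral_mono (measurable_gaussianPDF _ _) fun x hx => ?_
  refine ENNReal.ofReal_le_ofReal ?_
  rw [gaussianPDFReal]
  gcongr ?_ * Real.exp ?_
  · gcongr
  · rw [neg_div, neg_le_neg_iff, sub_zero]
    have hx2 : x ^ 2 ≤ 2 * (m ^ 2 + δ ^ 2) := by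
      have h2 : (x - m) ^ 2 ≤ δ ^ 2 := sq_le_sq' (by linarith [hx.1]) (by linarith [hx.2])
      nlinarith [sq_nonneg (x - 2 * m)]
    calc x ^ 2 / (2 * v) ≤ x ^ 2 / a := by gcongr; linarith
      _ ≤ _ := by gcongr

end Gaussian

/-! ### Divergence and chi-square tails in the sequence model -/

section SequenceModel

theorem seqModel_apply (n : ℕ) (θ : ℕ+ → ℝ) :
    seqModel n θ = Measure.infinitePi fun i => gaussianReal (θ i) ((n : ℝ≥0)⁻¹) := rfl

theorem seqModel_sq_le {n : ℕ} (hn : n ≠ 0) {θ θ' : ℕ+ → ℝ} {c : ℝ} (hc : 0 ≤ c)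
    (h : ∑' j, ENNReal.ofReal ((θ j - θ' j) ^ 2) ≤ ENNReal.ofReal c)
    {A : Set (ℕ+ → ℝ)} (hA : MeasurableSet A) :
    seqModel n θ A ^ 2 ≤ ENNReal.ofReal (Real.exp (n * c)) * seqModel n θ' A := by
  have hv : (n : ℝ≥0)⁻¹ ≠ 0 := by simpa using hn
  refine infinitePi_sq_le _ _ (fun i => measurable_gaussianRatio (θ' i) (θ i) ((n : ℝ≥0)⁻¹))
    (fun i => gaussianReal_eq_withDensity _ _ hv) ENNReal.ofReal_ne_top (fun s => ?_) hA
  simp_rw [lintegral_gaussianRatio_sq _ _ hv]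
  rw [← ENNReal.ofReal_prod_of_nonneg fun i _ => (Real.exp_pos _).le, ← Real.exp_sum]
  refine ENNReal.ofReal_le_ofReal (Real.exp_le_exp.2 ?_)
  have h1 : ∑ i ∈ s, (θ i - θ' i) ^ 2 ≤ c := by
    rw [← ENNReal.ofReal_le_ofReal_iff hc, ENNReal.ofReal_sum_of_nonneg fun i _ => sq_nonneg _]
    exact (ENNReal.sum_le_tsum s).trans h
  push_cast
  simp_rw [div_inv_eq_mul]
  rw [← Finset.sum_mul, mul_comm]
  gcongr

theorem seqModel_absolutelyContinuous {n : ℕ} (hn : n ≠ 0) {θ θ' : ℕ+ → ℝ} {c : ℝ} (hc : 0 ≤ c)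
    (h : ∑' j, ENNReal.ofReal ((θ j - θ' j) ^ 2) ≤ ENNReal.ofReal c) :
    seqModel n θ ≪ seqModel n θ' := by
  refine Measure.AbsolutelyContinuous.mk fun A hA h0 => ?_
  have := seqModel_sq_le hn hc h hA
  rw [h0, mul_zero] at this
  simpa using this

/-- Chernoff with parameter 1/4: each squared standard normal contributes √2 ≤ exp(1/2). -/
theorem seqModel_chi_sq_tail {n : ℕ} (hn : n ≠ 0) (θ : ℕ+ → ℝ) (s : Finset ℕ+) (r : ℝ) :
    seqModel n θ {x | r ≤ ∑ j ∈ s, (n : ℝ) * (x j - θ j) ^ 2} ≤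
      ENNReal.ofReal (Real.exp (s.card / 2 - r / 4)) := by
  have hv : (n : ℝ≥0)⁻¹ ≠ 0 := by simpa using hn
  have h1 : ∫⁻ x, ∏ j ∈ s, ENNReal.ofReal (Real.exp ((n : ℝ) * (x j - θ j) ^ 2 / 4))
      ∂seqModel n θ = ENNReal.ofReal (Real.sqrt 2) ^ s.card := by
    rw [seqModel_apply, lintegral_finset_prod_infinitePi _ s
      (f := fun j y => ENNReal.ofReal (Real.exp ((n : ℝ) * (y - θ j) ^ 2 / 4)))
      (fun j => by fun_prop)]
    rw [← Finset.prod_const]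
    refine Finset.prod_congr rfl fun j _ => ?_
    rw [← lintegral_exp_sq_gaussianReal (θ j) hv]
    simp
  have h2 : ENNReal.ofReal (Real.exp (r / 4)) *
      seqModel n θ {x | r ≤ ∑ j ∈ s, (n : ℝ) * (x j - θ j) ^ 2} ≤
      ENNReal.ofReal (Real.sqrt 2) ^ s.card := by
    rw [← h1]
    refine le_trans ?_ (mul_meas_ge_le_lintegral (by fun_prop) (ENNReal.ofReal (Real.exp (r / 4))))
    gcongr with x
    intro hx
    rw [← ENNReal.ofReal_prod_of_nonneg fun i _ => (Real.exp_pos _).le, ← Real.exp_sum,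
      ← Finset.sum_div]
    gcongr
  have h3 : ENNReal.ofReal (Real.sqrt 2) ^ s.card ≤ ENNReal.ofReal (Real.exp (s.card / 2)) := by
    rw [← ENNReal.ofReal_pow (Real.sqrt_nonneg _)]
    refine ENNReal.ofReal_le_ofReal ?_
    have h4 : Real.sqrt 2 ≤ Real.exp (1 / 2) := by
      refine Real.sqrt_le_iff.2 ⟨(Real.exp_pos _).le, ?_⟩
      rw [← Real.exp_nat_mul]
      have := Real.add_one_le_exp (1 : ℝ)
      norm_num
      linarith
    calc Real.sqrt 2 ^ s.card ≤ Real.exp (1 / 2) ^ s.card := by gcongr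
      _ = _ := by rw [← Real.exp_nat_mul]; congr 1; ring
  rw [sub_eq_add_neg, Real.exp_add, ENNReal.ofReal_mul (Real.exp_pos _).le, Real.exp_neg,
    ENNReal.ofReal_inv_of_pos (Real.exp_pos _), ← div_eq_mul_inv,
    ENNReal.le_div_iff_mul_le (Or.inl (by simp [Real.exp_pos])) (Or.inl ENNReal.ofReal_ne_top),
    mul_comm]
  exact h2.trans h3

end SequenceModel

/-! ### Dyadic blocks as a partition of the indices -/

section Blocks

/-- The index at position `l` of the dyadic block of level `k`. -/
def blockIndex (k : ℕ) (l : Fin (2 ^ k)) : ℕ+ :=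
  ⟨2 ^ k + (l : ℕ), Nat.add_pos_left (pow_pos two_pos k) _⟩

theorem block_apply (θ : ℕ+ → ℝ) (k : ℕ) (l : Fin (2 ^ k)) : block θ k l = θ (blockIndex k l) := rfl

theorem log_blockIndex (k : ℕ) (l : Fin (2 ^ k)) : Nat.log 2 (blockIndex k l : ℕ) = k := by
  refine (Nat.log_eq_iff (Or.inr ⟨one_lt_two, by simp⟩)).2 ⟨?_, ?_⟩
  · change 2 ^ k ≤ 2 ^ k + (l : ℕ)
    omega
  · change 2 ^ k + (l : ℕ) < 2 ^ (k + 1)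
    have := l.2
    rw [pow_succ]
    omega

theorem bijective_blockIndex :
    Function.Bijective fun z : Σ k, Fin (2 ^ k) => blockIndex z.1 z.2 := by
  constructor
  · rintro ⟨k, l⟩ ⟨k', l'⟩ h
    simp only at h
    have hk : k = k' := by rw [← log_blockIndex k l, h, log_blockIndex]
    subst hk
    have : 2 ^ k + (l : ℕ) = 2 ^ k + (l' : ℕ) := congrArg (fun j : ℕ+ => (j : ℕ)) h
    rw [Fin.ext (Nat.add_left_cancel this)]
  · intro j
    have h1 := Nat.pow_log_le_self 2 j.ne_zero
    have h2 := Nat.lt_pow_succ_log_self one_lt_two (j : ℕ)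
    rw [pow_succ] at h2
    refine ⟨⟨Nat.log 2 j, ⟨j - 2 ^ Nat.log 2 j, by omega⟩⟩, PNat.eq ?_⟩
    change 2 ^ Nat.log 2 (j : ℕ) + ((j : ℕ) - 2 ^ Nat.log 2 (j : ℕ)) = j
    omega

theorem tsum_eq_tsum_blocks (f : ℕ+ → ℝ≥0∞) :
    ∑' j, f j = ∑' k, ∑ l : Fin (2 ^ k), f (blockIndex k l) := by
  rw [← (Equiv.ofBijective _ bijective_blockIndex).tsum_eq, ENNReal.tsum_sigma']
  simp_rw [tsum_fintype]
  rfl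

/-- The indices in the blocks of level less than `K`. -/
noncomputable def head (K : ℕ) : Finset ℕ+ :=
  ((Finset.range K).sigma fun _ => Finset.univ).map
    (Equiv.ofBijective _ bijective_blockIndex).toEmbedding

theorem sum_head {M : Type*} [AddCommMonoid M] (K : ℕ) (f : ℕ+ → M) :
    ∑ j ∈ head K, f j = ∑ k ∈ Finset.range K, ∑ l : Fin (2 ^ k), f (blockIndex k l) := by
  rw [head, Finset.sum_map, Finset.sum_sigma]
  rfl

theorem card_head_le (K : ℕ) : (head K).card ≤ 2 ^ K := by
  have h : ∀ K, (∑ k ∈ Finset.range K, 2 ^ k) < 2 ^ K := fun K => by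
    induction K with
    | zero => simp
    | succ K ih => rw [Finset.sum_range_succ, pow_succ]; omega
  rw [head, Finset.card_map, Finset.card_sigma]
  simpa using (h K).le

theorem tsum_eq_sum_head_add (f : ℕ+ → ℝ≥0∞) (K : ℕ) :
    ∑' j, f j = ∑ j ∈ head K, f j + ∑' i, ∑ l : Fin (2 ^ (i + K)), f (blockIndex (i + K) l) := by
  rw [tsum_eq_tsum_blocks, sum_head]
  exact (ENNReal.summable.sum_add_tsum_nat_add' (k := K)).symm

end Blocks

/-! ### Block norms in a Besov ball -/

section Besov

/-- The squared `ℓ²` norms of the blocks of a sequence of smoothness `α`. -/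
noncomputable def blockWeight (α : ℝ) (k : ℕ) : ℝ := (2 : ℝ) ^ (-(2 * α * k))

theorem blockWeight_pos (α : ℝ) (k : ℕ) : 0 < blockWeight α k := by
  unfold blockWeight; positivity

theorem blockWeight_eq_pow (α : ℝ) (k : ℕ) : blockWeight α k = ((2 : ℝ) ^ (-(2 * α))) ^ k := by
  rw [blockWeight, ← Real.rpow_natCast, ← Real.rpow_mul zero_le_two, neg_mul]

/-- The sum of the weights `2 ^ (-2αk)`. -/
noncomputable def weightSum (α : ℝ) : ℝ := (1 - (2 : ℝ) ^ (-(2 * α)))⁻¹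

theorem two_rpow_neg_lt_one {α : ℝ} (hα : 0 < α) : (2 : ℝ) ^ (-(2 * α)) < 1 :=
  Real.rpow_lt_one_of_one_lt_of_neg one_lt_two (by linarith)

theorem weightSum_pos {α : ℝ} (hα : 0 < α) : 0 < weightSum α :=
  inv_pos.2 (sub_pos.2 (two_rpow_neg_lt_one hα))

theorem tsum_blockWeight {α c : ℝ} (hα : 0 < α) (hc : 0 ≤ c) (K : ℕ) :
    ∑' i, ENNReal.ofReal (c * blockWeight α (i + K)) =
      ENNReal.ofReal (c * weightSum α * blockWeight α K) := by
  have h0 : (0 : ℝ) ≤ (2 : ℝ) ^ (-(2 * α)) := by positivity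
  have hs : HasSum (fun i => c * blockWeight α (i + K)) (c * weightSum α * blockWeight α K) := by
    have h1 := (hasSum_geometric_of_lt_one h0 (two_rpow_neg_lt_one hα)).mul_left
      (c * blockWeight α K)
    rw [show c * weightSum α * blockWeight α K =
      c * blockWeight α K * (1 - (2 : ℝ) ^ (-(2 * α)))⁻¹ by rw [weightSum]; ring]
    refine h1.congr_fun fun i => ?_
    rw [blockWeight_eq_pow, blockWeight_eq_pow, pow_add]
    ring
  rw [← hs.tsum_eq, ENNReal.ofReal_tsum_of_nonneg (fun i => by
    have := blockWeight_pos α (i + K); positivity) hs.summable]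

/-- The ℓ^q condition bounds every level by `Q`. On 2^k coordinates the power mean inequality (p ≥
2) gives ‖·‖₂ ≤ 2^(k(1/2-1/p)) ‖·‖_p, exactly the excess of s over α. -/
theorem sum_block_sq_le {α : ℝ} {p q : ℝ≥0∞} {Q : ℝ} (hp : 2 ≤ p) (hq : 1 ≤ q)
    (hQ : 0 < Q) {θ : ℕ+ → ℝ} (hθ : θ ∈ besovBall α p q Q) (k : ℕ) :
    ∑ l, (block θ k l) ^ 2 ≤ Q ^ 2 * blockWeight α k := by
  have hlev : besovLevel α p θ k ≤ Q := by
    rw [besovBall, Set.mem_ofPred_eq] at hθ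
    split_ifs at hθ with h
    · exact hθ k
    · have hq0 : 0 < q.toReal := ENNReal.toReal_pos (by positivity) h
      have h1 := (ENNReal.le_tsum k).trans hθ
      rw [ENNReal.rpow_le_rpow_iff hq0] at h1
      exact (ENNReal.ofReal_le_ofReal_iff hQ.le).1 h1
  rw [besovLevel] at hlev
  rcases eq_or_ne p ∞ with rfl | hp'
  · have h1 : ∀ l, |block θ k l| ≤ ‖WithLp.toLp ∞ (block θ k)‖ := fun l =>
      PiLp.norm_apply_le (WithLp.toLp ∞ (block θ k)) l
    have h2 : ∀ l, (block θ k l) ^ 2 ≤ (Q * (2 : ℝ) ^ (-((α + 1 / 2) * k))) ^ 2 := by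
      intro l
      rw [← sq_abs]
      have h3 : ‖WithLp.toLp ∞ (block θ k)‖ ≤ Q * (2 : ℝ) ^ (-((α + 1 / 2) * k)) := by
        rw [Real.rpow_neg zero_le_two, ← div_eq_mul_inv, le_div_iff₀' (by positivity)]
        simpa using hlev
      exact pow_le_pow_left₀ (abs_nonneg _) ((h1 l).trans h3) 2
    refine (Finset.sum_le_card_nsmul _ _ _ fun l _ => h2 l).trans (le_of_eq ?_)
    rw [Finset.card_univ, Fintype.card_fin, nsmul_eq_mul, mul_pow, blockWeight,
      ← Real.rpow_natCast ((2 : ℝ) ^ _), ← Real.rpow_mul zero_le_two]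
    push_cast
    rw [← Real.rpow_natCast 2 k, mul_left_comm, ← Real.rpow_add two_pos]
    congr 2
    ring
  · have hP : 2 ≤ p.toReal := by
      rw [← ENNReal.toReal_ofNat 2]
      exact ENNReal.toReal_mono hp' hp
    set P := p.toReal with hPdef
    have hP0 : 0 < P := by linarith
    rw [PiLp.norm_eq_sum hP0, ENNReal.toReal_inv, ← hPdef] at hlev
    simp only [Real.norm_eq_abs] at hlev
    set T := ∑ l, |block θ k l| ^ P with hT
    have hT0 : 0 ≤ T := Finset.sum_nonneg fun l _ => by positivity
    have h1 : T ≤ (Q * (2 : ℝ) ^ (-((α + 1 / 2 - P⁻¹) * k))) ^ P := by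
      rw [← Real.rpow_inv_le_iff_of_pos hT0 (by positivity) hP0,
        Real.rpow_neg zero_le_two, ← div_eq_mul_inv, le_div_iff₀' (by positivity)]
      simpa only [one_div] using hlev
    have h2 := Real.rpow_sum_le_const_mul_sum_rpow_of_nonneg Finset.univ
      (f := fun l => (block θ k l) ^ 2) (p := P / 2) (by linarith) fun l _ => sq_nonneg _
    have h3 : ∀ l, ((block θ k l) ^ 2) ^ (P / 2) = |block θ k l| ^ P := by
      intro l
      rw [← sq_abs, ← Real.rpow_natCast, ← Real.rpow_mul (abs_nonneg _)]
      congr 1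
      push_cast
      ring
    simp_rw [h3] at h2
    rw [← hT, Finset.card_univ, Fintype.card_fin] at h2
    push_cast at h2
    have h4 : (∑ l, (block θ k l) ^ 2) ^ (P / 2) ≤ (Q ^ 2 * blockWeight α k) ^ (P / 2) := by
      refine h2.trans ((mul_le_mul_of_nonneg_left h1 (by positivity)).trans (le_of_eq ?_))
      rw [Real.mul_rpow (by positivity) (by positivity), Real.mul_rpow (by positivity)
        (blockWeight_pos α k).le, blockWeight, ← Real.rpow_natCast 2 k,
        ← Real.rpow_natCast Q 2, ← Real.rpow_mul hQ.le, ← Real.rpow_mul zero_le_two,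
        ← Real.rpow_mul zero_le_two, ← Real.rpow_mul zero_le_two, mul_left_comm,
        ← Real.rpow_add two_pos]
      congr 2
      · push_cast
        ring
      · field_simp
        ring
    exact (Real.rpow_le_rpow_iff (Finset.sum_nonneg fun l _ => sq_nonneg _)
      (mul_nonneg (sq_nonneg _) (blockWeight_pos α k).le) (by positivity)).1 h4

end Besov

/-! ### Lower bounds and tails of the mixing law -/

section MixingLaw

theorem two_rpow_le_exp {x : ℝ} (hx : 0 ≤ x) : (2 : ℝ) ^ x ≤ Real.exp x := by
  rw [Real.rpow_def_of_pos two_pos]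
  refine Real.exp_le_exp.2 ?_
  nlinarith [Real.log_two_lt_d9]

theorem exp_neg_le_two_rpow_neg {x : ℝ} (hx : 0 ≤ x) : Real.exp (-x) ≤ (2 : ℝ) ^ (-x) := by
  rw [Real.rpow_neg zero_le_two, Real.exp_neg]
  exact inv_anti₀ (by positivity) (two_rpow_le_exp hx)

theorem two_rpow_neg_le_exp {x : ℝ} (hx : 0 ≤ x) : (2 : ℝ) ^ (-x) ≤ Real.exp (-(x / 2)) := by
  rw [Real.rpow_def_of_pos two_pos]
  refine Real.exp_le_exp.2 ?_
  nlinarith [Real.log_two_gt_d9]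

theorem exp_neg_two_mul_le {x : ℝ} (hx : 0 ≤ x) (hx' : x ≤ 1 / 2) :
    Real.exp (-(2 * x)) ≤ 1 - x := by
  rw [Real.exp_neg]
  refine inv_le_of_inv_le₀ (by linarith) ?_
  refine le_trans ?_ (Real.add_one_le_exp (2 * x))
  rw [inv_le_iff_one_le_mul₀ (by linarith)]
  nlinarith

/-- The affine piece descends from `mixT k`, which is at least 2^(-2^k), to 2^(-2^k). -/
theorem le_mixDensity {k : ℕ} {t : ℝ} (h0 : 0 ≤ t) (h1 : t ≤ (2 : ℝ) ^ (-(k : ℝ))) :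
    (2 : ℝ) ^ (-(2 : ℝ) ^ k) ≤ mixDensity k t := by
  unfold mixDensity
  rw [if_neg (not_lt.2 h0)]
  split_ifs with h2
  · set B : ℝ := (2 : ℝ) ^ ((k : ℝ) ^ 2) with hB
    have hB0 : 0 < B := by positivity
    have hBt : B * t ≤ 1 := by
      have h3 : B * (2 : ℝ) ^ (-(k : ℝ) ^ 2) = 1 := by
        rw [hB, ← Real.rpow_add two_pos]; simp
      rw [← h3]
      gcongr
    have hT : (2 : ℝ) ^ (-(2 : ℝ) ^ k) ≤ mixT k := by
      have h3 : (2 : ℝ) ^ (-(2 : ℝ) ^ k + (k : ℝ) ^ 2 - k) ≤ (2 : ℝ) ^ ((k : ℝ) ^ 2) := by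
        refine Real.rpow_le_rpow_of_exponent_le one_le_two ?_
        have : (0 : ℝ) < (2 : ℝ) ^ k := by positivity
        have : (0 : ℝ) ≤ (k : ℝ) := k.cast_nonneg
        linarith
      unfold mixT
      linarith
    nlinarith [mul_nonneg (sub_nonneg.2 hBt) (sub_nonneg.2 hT)]
  · exact le_rfl

theorem le_mixLaw_Icc {k : ℕ} {a b : ℝ} (ha : 0 ≤ a) (hb : b ≤ (2 : ℝ) ^ (-(k : ℝ))) :
    ENNReal.ofReal ((2 : ℝ) ^ (-(2 : ℝ) ^ k) * (b - a)) ≤ mixLaw k (Set.Icc a b) := by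
  rw [mixLaw, withDensity_apply _ measurableSet_Icc, ENNReal.ofReal_mul (by positivity),
    ← Real.volume_Icc, ← setLIntegral_const]
  refine lintegral_mono_ae ?_
  refine (ae_restrict_iff' measurableSet_Icc).2 (ae_of_all _ fun t ht => ?_)
  exact ENNReal.ofReal_le_ofReal (le_mixDensity (ha.trans ht.1) (ht.2.trans hb))

theorem mixLaw_compl_Icc_le (k : ℕ) :
    mixLaw k (Set.Icc 0 ((2 : ℝ) ^ (-(k : ℝ) ^ 2)))ᶜ ≤
      ENNReal.ofReal ((2 : ℝ) ^ (-(2 : ℝ) ^ k)) := by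
  rw [mixLaw, withDensity_apply _ measurableSet_Icc.compl]
  have h1 : ∀ t ∈ (Set.Icc 0 ((2 : ℝ) ^ (-(k : ℝ) ^ 2)))ᶜ, ENNReal.ofReal (mixDensity k t) ≤
      (Set.Icc (0 : ℝ) 1).indicator (fun _ => ENNReal.ofReal ((2 : ℝ) ^ (-(2 : ℝ) ^ k))) t := by
    intro t ht
    unfold mixDensity
    split_ifs with h2 h3 h4
    · simp
    · exact absurd ⟨not_lt.1 h2, h3⟩ ht
    · rw [Set.indicator_of_mem]
      refine ⟨not_lt.1 h2, h4.trans (Real.rpow_le_one_of_one_le_of_nonpos one_le_two ?_)⟩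
      simp
    · simp
  refine (setLIntegral_mono (measurable_const.indicator measurableSet_Icc) h1).trans ?_
  refine (lintegral_mono' Measure.restrict_le_self le_rfl).trans ?_
  rw [lintegral_indicator measurableSet_Icc, setLIntegral_const, Real.volume_Icc]
  simp

/-- Since 2^(i+K) ≥ 2^K + i, the series is dominated by a geometric one of ratio exp(-1/2) ≤ 2/3. -/
theorem tsum_exp_neg_two_pow_le (K : ℕ) :
    ∑' i : ℕ, ENNReal.ofReal (Real.exp (-((2 : ℝ) ^ (i + K) / 2))) ≤
      ENNReal.ofReal (3 * Real.exp (-((2 : ℝ) ^ K / 2))) := by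
  have h0 : Real.exp (-(1 / 2)) ≤ 2 / 3 := by
    rw [Real.exp_neg]
    refine inv_le_of_inv_le₀ (by norm_num) ?_
    have := Real.add_one_le_exp (1 / 2 : ℝ)
    norm_num at this ⊢
    linarith
  have h1 : ∀ i : ℕ, Real.exp (-((2 : ℝ) ^ (i + K) / 2)) ≤
      Real.exp (-((2 : ℝ) ^ K / 2)) * (2 / 3) ^ i := by
    intro i
    have h2 : (2 : ℝ) ^ K + i ≤ 2 ^ (i + K) := by
      have h3 : (i : ℝ) + 1 ≤ 2 ^ i := by exact_mod_cast Nat.lt_two_pow_self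
      have h4 : (1 : ℝ) ≤ 2 ^ K := one_le_pow₀ one_le_two
      rw [pow_add]
      nlinarith [(i.cast_nonneg : (0 : ℝ) ≤ i)]
    calc _ ≤ Real.exp (-((2 : ℝ) ^ K / 2) + i * (-(1 / 2))) := Real.exp_le_exp.2 (by linarith)
      _ = Real.exp (-((2 : ℝ) ^ K / 2)) * Real.exp (-(1 / 2)) ^ i := by
        rw [Real.exp_add, Real.exp_nat_mul]
      _ ≤ _ := by gcongr
  have h2 : HasSum (fun i : ℕ => Real.exp (-((2 : ℝ) ^ K / 2)) * (2 / 3 : ℝ) ^ i)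
      (3 * Real.exp (-((2 : ℝ) ^ K / 2))) := by
    have h3 := (hasSum_geometric_of_lt_one (r := (2 / 3 : ℝ)) (by norm_num) (by norm_num)).mul_left
      (Real.exp (-((2 : ℝ) ^ K / 2)))
    rwa [show Real.exp (-((2 : ℝ) ^ K / 2)) * (1 - 2 / 3)⁻¹ = 3 * Real.exp (-((2 : ℝ) ^ K / 2)) by
      ring] at h3
  rw [← h2.tsum_eq, ENNReal.ofReal_tsum_of_nonneg (fun i => by positivity) h2.summable]
  exact ENNReal.tsum_le_tsum fun i => ENNReal.ofReal_le_ofReal (h1 i)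

end MixingLaw

/-! ### The sieve and its prior probability -/

section Sieve

/-- The radius at level `k` of the coordinates in the sieve. -/
noncomputable def sieveRadius (α : ℝ) (k : ℕ) : ℝ := (2 : ℝ) ^ (-((2 * α + 1) * k / 2))

theorem sieveRadius_pos (α : ℝ) (k : ℕ) : 0 < sieveRadius α k := by
  unfold sieveRadius; positivity

theorem sieveRadius_sq (α : ℝ) (k : ℕ) : sieveRadius α k ^ 2 = (2 : ℝ) ^ (-((2 * α + 1) * k)) := by
  rw [sieveRadius, ← Real.rpow_natCast, ← Real.rpow_mul zero_le_two]
  congr 1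
  push_cast
  ring

/-- The reason for the choice of radius: a block within it obeys the Besov block bound with Q = 1.
-/
theorem two_pow_mul_sieveRadius_sq (α : ℝ) (k : ℕ) :
    (2 : ℝ) ^ k * sieveRadius α k ^ 2 = blockWeight α k := by
  rw [sieveRadius_sq, blockWeight, ← Real.rpow_natCast, ← Real.rpow_add two_pos]
  congr 1
  ring

theorem priorGivenScales_apply (A : ℕ → ℝ) :
    priorGivenScales A =
      Measure.infinitePi fun j : ℕ+ => gaussianReal 0 (A (Nat.log 2 (j : ℕ))).toNNReal := rfl

instance : IsMarkovKernel priorGivenScales :=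
  ⟨fun A => by rw [priorGivenScales_apply]; infer_instance⟩

instance : IsProbabilityMeasure blockPrior := by
  unfold blockPrior; infer_instance

theorem blockPrior_apply {S : Set (ℕ+ → ℝ)} (hS : MeasurableSet S) :
    blockPrior S = ∫⁻ A, priorGivenScales A S ∂Measure.infinitePi mixLaw :=
  Measure.bind_apply hS (Kernel.aemeasurable _)

/-- Small scales produce coordinates in the sieve. -/
theorem gaussianReal_sieve_compl_le {α : ℝ} (hα : 0 < α) {k : ℕ} (hk : 2 * α + 5 ≤ k) {v : ℝ≥0}
    (hv : (v : ℝ) ≤ (2 : ℝ) ^ (-(k : ℝ) ^ 2)) :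
    gaussianReal 0 v {x | sieveRadius α k < |x|} ≤
      ENNReal.ofReal (2 * Real.exp (-(4 * (2 : ℝ) ^ k))) := by
  refine (gaussianReal_abs_gt_le (by positivity) hv (sieveRadius_pos α k).le).trans ?_
  refine ENNReal.ofReal_le_ofReal ?_
  gcongr
  rw [sieveRadius_sq, le_div_iff₀ (by positivity)]
  have h1 : 4 * (2 : ℝ) ^ k * (2 * (2 : ℝ) ^ (-(k : ℝ) ^ 2)) =
      (2 : ℝ) ^ (3 + (k : ℝ) - (k : ℝ) ^ 2) := by
    rw [sub_eq_add_neg, Real.rpow_add two_pos, Real.rpow_add two_pos, Real.rpow_natCast]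
    norm_num
    ring
  rw [h1]
  refine Real.rpow_le_rpow_of_exponent_le one_le_two ?_
  nlinarith

/-- Either the scale exceeds 2^(-k²), which has probability at most 2^(-2^k), or the coordinate is
Gaussian with a variance far below the squared radius. -/
theorem blockPrior_abs_gt_le {α : ℝ} (hα : 0 < α) {k : ℕ} (hk : 2 * α + 5 ≤ k) (l : Fin (2 ^ k)) :
    blockPrior {θ | sieveRadius α k < |θ (blockIndex k l)|} ≤
      ENNReal.ofReal ((2 : ℝ) ^ (-(2 : ℝ) ^ k) + 2 * Real.exp (-(4 * (2 : ℝ) ^ k))) := by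
  have hm : MeasurableSet {x : ℝ | sieveRadius α k < |x|} :=
    measurableSet_lt measurable_const measurable_id.abs
  have hS : MeasurableSet {θ : ℕ+ → ℝ | sieveRadius α k < |θ (blockIndex k l)|} :=
    measurableSet_lt measurable_const (measurable_pi_apply (blockIndex k l)).abs
  rw [blockPrior_apply hS]
  set I : Set ℝ := Set.Icc 0 ((2 : ℝ) ^ (-(k : ℝ) ^ 2)) with hI
  have hIm : MeasurableSet (Function.eval k ⁻¹' I : Set (ℕ → ℝ)) :=
    measurable_pi_apply k measurableSet_Icc
  have h1 : ∀ A : ℕ → ℝ, priorGivenScales A {θ | sieveRadius α k < |θ (blockIndex k l)|} =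
      gaussianReal 0 (A k).toNNReal {x | sieveRadius α k < |x|} := by
    intro A
    have := (measurePreserving_eval_infinitePi
      (fun j : ℕ+ => gaussianReal 0 (A (Nat.log 2 (j : ℕ))).toNNReal)
      (blockIndex k l)).measure_preimage hm.nullMeasurableSet
    rw [log_blockIndex] at this
    exact this
  simp_rw [h1]
  rw [← lintegral_add_compl _ hIm, add_comm, ENNReal.ofReal_add (by positivity) (by positivity)]
  refine add_le_add ?_ ?_
  · calc _ ≤ ∫⁻ A in (Function.eval k ⁻¹' I : Set (ℕ → ℝ))ᶜ, 1 ∂Measure.infinitePi mixLaw :=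
          lintegral_mono fun A => prob_le_one
      _ = mixLaw k Iᶜ := by
          rw [setLIntegral_one, ← Set.preimage_compl]
          exact (measurePreserving_eval_infinitePi mixLaw k).measure_preimage
            measurableSet_Icc.compl.nullMeasurableSet
      _ ≤ _ := mixLaw_compl_Icc_le k
  · calc _ ≤ ∫⁻ A in (Function.eval k ⁻¹' I : Set (ℕ → ℝ)),
          ENNReal.ofReal (2 * Real.exp (-(4 * (2 : ℝ) ^ k))) ∂Measure.infinitePi mixLaw := by
          refine setLIntegral_mono measurable_const fun A hA => ?_
          refine gaussianReal_sieve_compl_le hα hk ?_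
          rw [Real.coe_toNNReal _ hA.1]
          exact hA.2
      _ ≤ _ := by
          rw [setLIntegral_const]
          exact mul_le_of_le_one_right' prob_le_one

/-- The sequences whose coordinates of level at least `K` are bounded by the radii. -/
def sieve (α : ℝ) (K : ℕ) : Set (ℕ+ → ℝ) :=
  {θ | ∀ i, ∀ l : Fin (2 ^ (i + K)), |θ (blockIndex (i + K) l)| ≤ sieveRadius α (i + K)}

theorem blockPrior_sieve_compl_le {α : ℝ} (hα : 0 < α) {K : ℕ} (hK : 2 * α + 5 ≤ K) :
    blockPrior (sieve α K)ᶜ ≤ ENNReal.ofReal (24 * Real.exp (-((2 : ℝ) ^ K / 2))) := by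
  have h1 : (sieve α K)ᶜ ⊆ ⋃ i : ℕ, ⋃ l : Fin (2 ^ (i + K)),
      {θ | sieveRadius α (i + K) < |θ (blockIndex (i + K) l)|} := by
    intro θ hθ
    simp only [sieve, Set.mem_compl_iff, Set.mem_ofPred_eq, not_forall, not_le] at hθ
    obtain ⟨i, l, h⟩ := hθ
    exact Set.mem_iUnion.2 ⟨i, Set.mem_iUnion.2 ⟨l, h⟩⟩
  have h2 : ∀ k : ℕ, (2 : ℝ) ^ k * ((2 : ℝ) ^ (-(2 : ℝ) ^ k) + 2 * Real.exp (-(4 * (2 : ℝ) ^ k))) ≤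
      8 * Real.exp (-((2 : ℝ) ^ k / 2)) := by
    intro k
    set x : ℝ := (2 : ℝ) ^ k with hx
    have hx0 : 0 < x := by positivity
    -- The union bound over 2^k coordinates costs a factor x, paid for by exp(x/6); as log 2 > 2/3,
    -- the rate 2/3 - 1/6 = 1/2 remains.
    have h3 : x ≤ 6 * Real.exp (x / 6) := by
      have := Real.add_one_le_exp (x / 6)
      linarith
    have h4 : (2 : ℝ) ^ (-x) ≤ Real.exp (-(2 / 3 * x)) := by
      rw [Real.rpow_def_of_pos two_pos]
      refine Real.exp_le_exp.2 ?_
      nlinarith [Real.log_two_gt_d9]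
    have h5 : x * (2 : ℝ) ^ (-x) ≤ 6 * Real.exp (-(x / 2)) := by
      calc x * (2 : ℝ) ^ (-x) ≤ 6 * Real.exp (x / 6) * Real.exp (-(2 / 3 * x)) := by gcongr
        _ = 6 * Real.exp (-(x / 2)) := by
          rw [mul_assoc, ← Real.exp_add]
          congr 2
          ring
    have h6 : x * Real.exp (-(4 * x)) ≤ Real.exp (-(x / 2)) := by
      have h7 : x ≤ Real.exp x := by linarith [Real.add_one_le_exp x]
      calc x * Real.exp (-(4 * x)) ≤ Real.exp x * Real.exp (-(4 * x)) := by gcongr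
        _ = Real.exp (x + -(4 * x)) := (Real.exp_add _ _).symm
        _ ≤ _ := Real.exp_le_exp.2 (by linarith)
    nlinarith
  calc blockPrior (sieve α K)ᶜ
      ≤ ∑' i : ℕ, ∑ l : Fin (2 ^ (i + K)),
        blockPrior {θ | sieveRadius α (i + K) < |θ (blockIndex (i + K) l)|} := by
        refine (measure_mono h1).trans ((measure_iUnion_le _).trans ?_)
        exact ENNReal.tsum_le_tsum fun i => measure_iUnion_fintype_le _ _
    _ ≤ ∑' i : ℕ, ENNReal.ofReal (8 * Real.exp (-((2 : ℝ) ^ (i + K) / 2))) := by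
        refine ENNReal.tsum_le_tsum fun i => ?_
        refine (Finset.sum_le_card_nsmul _ _ _ fun l _ => blockPrior_abs_gt_le hα (by
          push_cast; linarith [(i.cast_nonneg : (0 : ℝ) ≤ i)]) l).trans ?_
        rw [Finset.card_univ, Fintype.card_fin, ← ENNReal.ofReal_nsmul, nsmul_eq_mul]
        push_cast
        exact ENNReal.ofReal_le_ofReal (h2 (i + K))
    _ ≤ _ := by
        simp_rw [ENNReal.ofReal_mul (show (0 : ℝ) ≤ 8 by norm_num)]
        rw [ENNReal.tsum_mul_left]
        refine (mul_le_mul_right (tsum_exp_neg_two_pow_le K) _).trans (le_of_eq ?_)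
        rw [← ENNReal.ofReal_mul (by norm_num), ← mul_assoc]
        norm_num

end Sieve

/-! ### Prior mass around the truth -/

section PriorMass

/-- Why no logarithm is lost: a cost per coordinate that grows linearly in K - k is absorbed by the
geometric sizes of the blocks. -/
theorem sum_two_pow_mul_le (a b : ℝ) (ha : 0 ≤ a) (K : ℕ) (hb : 0 ≤ b) :
    ∑ k ∈ Finset.range K, (2 : ℝ) ^ k * (a + b * (K + 1 - k)) ≤ (a + 3 * b) * 2 ^ K := by
  have h0 : ∀ K : ℕ, ∑ k ∈ Finset.range K, (2 : ℝ) ^ k = 2 ^ K - 1 := fun K => by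
    induction K with
    | zero => simp
    | succ K ih => rw [Finset.sum_range_succ, ih, pow_succ]; ring
  induction K with
  | zero => simp; positivity
  | succ K ih =>
    rw [Finset.sum_range_succ]
    have h1 : ∑ k ∈ Finset.range K, (2 : ℝ) ^ k * (a + b * ((K + 1 : ℕ) + 1 - k)) =
        ∑ k ∈ Finset.range K, (2 : ℝ) ^ k * (a + b * (K + 1 - k)) + b * (2 ^ K - 1) := by
      rw [← h0, Finset.mul_sum, ← Finset.sum_add_distrib]
      refine Finset.sum_congr rfl fun k _ => ?_
      push_cast
      ring
    rw [h1, pow_succ]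
    push_cast
    have h2 : (0 : ℝ) < 2 ^ K := by positivity
    nlinarith

/-- The intervals of admissible scales. -/
noncomputable def scaleBox (α : ℝ) (K k : ℕ) : Set ℝ :=
  if k < K then Set.Icc ((2 : ℝ) ^ (-((2 * α + 1) * k)) / 2) ((2 : ℝ) ^ (-((2 * α + 1) * k)))
  else Set.Icc 0 ((2 : ℝ) ^ (-(k : ℝ) ^ 2))

theorem measurableSet_scaleBox (α : ℝ) (K k : ℕ) : MeasurableSet (scaleBox α K k) := by
  unfold scaleBox; split_ifs <;> exact measurableSet_Icc

/-- Level k < K costs at most 2^k + (2α+1)k + 1 ≤ (2α+3) 2^k in the exponent; the levels from K on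
cost at most 6 altogether. -/
theorem le_infinitePi_mixLaw_scaleBox {α : ℝ} (hα : 0 < α) (K : ℕ) :
    ENNReal.ofReal (Real.exp (-((2 * α + 9) * 2 ^ K))) ≤
      Measure.infinitePi mixLaw (Set.univ.pi (scaleBox α K)) := by
  have hK : (1 : ℝ) ≤ 2 ^ K := one_le_pow₀ one_le_two
  refine exp_neg_tsum_le_infinitePi mixLaw (measurableSet_scaleBox α K)
    (b := fun k => ENNReal.ofReal (if k < K then (2 : ℝ) ^ k * (2 * α + 3 + 0 * (K + 1 - k))
      else 2 * Real.exp (-((2 : ℝ) ^ k / 2)))) ?_ (by positivity) fun k => ?_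
  · rw [← ENNReal.summable.sum_add_tsum_nat_add' (k := K),
      show (2 * α + 9) * (2 : ℝ) ^ K = (2 * α + 3 + 3 * 0) * 2 ^ K + 6 * 2 ^ K by ring,
      ENNReal.ofReal_add (by positivity) (by positivity)]
    refine add_le_add ?_ ?_
    · rw [← ENNReal.ofReal_sum_of_nonneg]
      · refine ENNReal.ofReal_le_ofReal (le_trans (le_of_eq ?_)
          (sum_two_pow_mul_le (2 * α + 3) 0 (by positivity) K le_rfl))
        exact Finset.sum_congr rfl fun k hk => if_pos (Finset.mem_range.1 hk)
      · intro k _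
        split_ifs <;> [(rw [zero_mul]; positivity); positivity]
    · calc _ = ∑' i : ℕ, ENNReal.ofReal 2 *
            ENNReal.ofReal (Real.exp (-((2 : ℝ) ^ (i + K) / 2))) := by
            refine tsum_congr fun i => ?_
            rw [if_neg (by omega), ENNReal.ofReal_mul zero_le_two]
        _ ≤ ENNReal.ofReal 2 * ENNReal.ofReal (3 * Real.exp (-((2 : ℝ) ^ K / 2))) := by
            rw [ENNReal.tsum_mul_left]
            exact mul_le_mul_right (tsum_exp_neg_two_pow_le K) _
        _ ≤ _ := by
            rw [← ENNReal.ofReal_mul zero_le_two]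
            refine ENNReal.ofReal_le_ofReal ?_
            have : Real.exp (-((2 : ℝ) ^ K / 2)) ≤ 1 := Real.exp_le_one_iff.2 (by linarith)
            linarith
  · have h2k : (1 : ℝ) ≤ 2 ^ k := one_le_pow₀ one_le_two
    unfold scaleBox
    split_ifs with hk
    · rw [zero_mul, add_zero, ENNReal.toReal_ofReal (by positivity)]
      refine le_trans (ENNReal.ofReal_le_ofReal ?_) (le_mixLaw_Icc (by positivity) ?_)
      · rw [sub_half, ← mul_div_assoc, ← Real.rpow_add two_pos, ← Real.rpow_sub_one two_ne_zero,
          show -(2 : ℝ) ^ k + -((2 * α + 1) * k) - 1 = -((2 : ℝ) ^ k + (2 * α + 1) * k + 1) by ring]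
        refine le_trans ?_ (exp_neg_le_two_rpow_neg (by positivity))
        refine Real.exp_le_exp.2 (neg_le_neg ?_)
        have h3 : (k : ℝ) + 1 ≤ 2 ^ k := by exact_mod_cast Nat.lt_two_pow_self
        nlinarith
      · refine Real.rpow_le_rpow_of_exponent_le one_le_two (neg_le_neg ?_)
        nlinarith [(k.cast_nonneg : (0 : ℝ) ≤ k)]
    · rw [ENNReal.toReal_ofReal (by positivity)]
      set x : ℝ := (2 : ℝ) ^ (-(2 : ℝ) ^ k) with hx
      have hx0 : 0 ≤ x := by positivity
      have hx1 : x ≤ 1 / 2 := by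
        rw [hx, one_div, ← Real.rpow_neg_one]
        exact Real.rpow_le_rpow_of_exponent_le one_le_two (by linarith)
      have hx2 : x ≤ Real.exp (-((2 : ℝ) ^ k / 2)) := two_rpow_neg_le_exp (by positivity)
      have h1 := prob_compl_eq_one_sub (μ := mixLaw k)
        (measurableSet_Icc (a := (0 : ℝ)) (b := (2 : ℝ) ^ (-(k : ℝ) ^ 2))).compl
      rw [compl_compl] at h1
      rw [h1]
      refine le_trans ?_ (tsub_le_tsub_left (mixLaw_compl_Icc_le k) 1)
      rw [← ENNReal.ofReal_one, ← ENNReal.ofReal_sub _ hx0]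
      refine ENNReal.ofReal_le_ofReal (le_trans ?_ (exp_neg_two_mul_le hx0 hx1))
      exact Real.exp_le_exp.2 (by linarith)

/-- The coordinate intervals of a neighbourhood of `θ₀`. -/
noncomputable def paramBox (α : ℝ) (n K : ℕ) (θ₀ : ℕ+ → ℝ) (j : ℕ+) : Set ℝ :=
  if Nat.log 2 (j : ℕ) < K then Set.Icc (θ₀ j - (Real.sqrt n)⁻¹) (θ₀ j + (Real.sqrt n)⁻¹)
  else {x | sieveRadius α (Nat.log 2 (j : ℕ)) < |x|}ᶜ

theorem measurableSet_paramBox (α : ℝ) (n K : ℕ) (θ₀ : ℕ+ → ℝ) (j : ℕ+) :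
    MeasurableSet (paramBox α n K θ₀ j) := by
  unfold paramBox
  split_ifs
  · exact measurableSet_Icc
  · exact (measurableSet_lt measurable_const measurable_id.abs).compl

/-- With a = 2^(-(2α+1)k), the window n^(-1/2) is narrower than the standard deviation by a factor
of order √(na), where 1 ≤ na ≤ 2^((2α+1)(K+1-k)); this gives the linear term. The last term comes
from the density at `m`, and `1 ≤ n * a` keeps the effect of the window bounded. -/
theorem le_gaussianReal_head {α : ℝ} (hα : 0 < α) {n K k : ℕ} (hk : k < K)
    (hn : (2 : ℝ) ^ ((2 * α + 1) * K) ≤ n) (hn' : (n : ℝ) ≤ (2 : ℝ) ^ ((2 * α + 1) * (K + 1)))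
    (m : ℝ) {v : ℝ} (hv : v ∈ Set.Icc ((2 : ℝ) ^ (-((2 * α + 1) * k)) / 2)
      ((2 : ℝ) ^ (-((2 * α + 1) * k)))) :
    ENNReal.ofReal (Real.exp (-(3 + (2 * α + 1) * (K + 1 - k) +
      2 * (m ^ 2 * (2 : ℝ) ^ ((2 * α + 1) * k))))) ≤
      gaussianReal 0 v.toNNReal (Set.Icc (m - (Real.sqrt n)⁻¹) (m + (Real.sqrt n)⁻¹)) := by
  have hn0 : (0 : ℝ) < n := lt_of_lt_of_le (by positivity) hn
  have hk' : (k : ℝ) + 1 ≤ K := by exact_mod_cast hk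
  set a : ℝ := (2 : ℝ) ^ (-((2 * α + 1) * k)) with ha
  have ha0 : 0 < a := by positivity
  have hv0 : 0 ≤ v := le_trans (by positivity) hv.1
  refine le_trans (ENNReal.ofReal_le_ofReal ?_) (le_gaussianReal_Icc ha0
    (by rw [Real.coe_toNNReal _ hv0]; exact hv.2) (by rw [Real.coe_toNNReal _ hv0]; exact hv.1))
  set x : ℝ := (2 * α + 1) * (K + 1 - k) with hx
  have hx0 : 0 ≤ x := mul_nonneg (by linarith) (by linarith)
  have hainv : (2 : ℝ) ^ ((2 * α + 1) * k) = a⁻¹ := by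
    rw [ha, Real.rpow_neg zero_le_two, inv_inv]
  have hna : 1 ≤ n * a := by
    rw [← div_le_iff₀ ha0, one_div, ← hainv]
    refine le_trans (Real.rpow_le_rpow_of_exponent_le one_le_two ?_) hn
    gcongr
  have hna' : n * a ≤ Real.exp x := by
    calc n * a ≤ (2 : ℝ) ^ ((2 * α + 1) * (K + 1)) * a := by gcongr
      _ = (2 : ℝ) ^ x := by
        rw [ha, ← Real.rpow_add two_pos, hx]
        congr 1
        ring
      _ ≤ _ := two_rpow_le_exp hx0
  have hsq : (Real.sqrt n)⁻¹ ^ 2 = (n : ℝ)⁻¹ := by rw [inv_pow, Real.sq_sqrt hn0.le]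
  rw [show -(3 + x + 2 * (m ^ 2 * (2 : ℝ) ^ ((2 * α + 1) * k))) =
    -(1 + x) + -(2 * (m ^ 2 * (2 : ℝ) ^ ((2 * α + 1) * k)) + 2) by ring, Real.exp_add]
  refine mul_le_mul ?_ ?_ (Real.exp_pos _).le (by positivity)
  · rw [le_div_iff₀ (by positivity), Real.exp_neg, inv_mul_le_iff₀ (Real.exp_pos _)]
    refine Real.sqrt_le_iff.2 ⟨by positivity, ?_⟩
    rw [mul_pow, mul_pow, hsq, ← Real.exp_nat_mul]
    have h1 : 2 * Real.pi * (n * a) ≤ Real.exp (1 + x) ^ 2 * 4 := by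
      have h2 : Real.exp (1 + x) ^ 2 = Real.exp 1 ^ 2 * Real.exp x * Real.exp x := by
        rw [Real.exp_add]; ring
      have h3 : 2 ≤ Real.exp 1 := by linarith [Real.add_one_le_exp (1 : ℝ)]
      have h4 : 1 ≤ Real.exp x := Real.one_le_exp hx0
      have h5 : (4 : ℝ) ≤ Real.exp 1 ^ 2 := by nlinarith
      rw [h2]
      calc 2 * Real.pi * (n * a) ≤ 2 * 4 * Real.exp x := by
            gcongr
            exact Real.pi_le_four
        _ ≤ 4 * Real.exp x * 1 * 4 := by nlinarith
        _ ≤ _ := by gcongr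
    rw [← Real.exp_nat_mul] at h1
    calc 2 * Real.pi * a = 2 * Real.pi * (n * a) * (n : ℝ)⁻¹ := by field_simp
      _ ≤ _ := (mul_le_mul_of_nonneg_right h1 (by positivity)).trans (le_of_eq (by ring))
  · refine Real.exp_le_exp.2 (neg_le_neg ?_)
    rw [hsq, hainv, div_le_iff₀ ha0]
    have h1 : (n : ℝ)⁻¹ ≤ a := by
      rw [inv_le_iff_one_le_mul₀ hn0, mul_comm]
      exact hna
    have h2 : m ^ 2 * a⁻¹ * a = m ^ 2 := by field_simp
    nlinarith

theorem le_priorGivenScales_paramBox {α Q : ℝ} (hα : 0 < α) {n K : ℕ} (hK : 2 * α + 5 ≤ K)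
    (hn : (2 : ℝ) ^ ((2 * α + 1) * K) ≤ n) (hn' : (n : ℝ) ≤ (2 : ℝ) ^ ((2 * α + 1) * (K + 1)))
    {θ₀ : ℕ+ → ℝ} (hθ : ∀ k, ∑ l, (block θ₀ k l) ^ 2 ≤ Q ^ 2 * blockWeight α k)
    {A : ℕ → ℝ} (hA : A ∈ Set.univ.pi (scaleBox α K)) :
    ENNReal.ofReal (Real.exp (-((6 * α + 2 * Q ^ 2 + 18) * 2 ^ K))) ≤
      priorGivenScales A (Set.univ.pi (paramBox α n K θ₀)) := by
  have hK1 : (1 : ℝ) ≤ 2 ^ K := one_le_pow₀ one_le_two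
  rw [priorGivenScales_apply]
  refine exp_neg_tsum_le_infinitePi _ (measurableSet_paramBox α n K θ₀)
    (b := fun j => ENNReal.ofReal (if Nat.log 2 (j : ℕ) < K then
      3 + (2 * α + 1) * (K + 1 - Nat.log 2 (j : ℕ)) +
        2 * (θ₀ j ^ 2 * (2 : ℝ) ^ ((2 * α + 1) * (Nat.log 2 (j : ℕ) : ℝ)))
      else 4 * Real.exp (-(4 * (2 : ℝ) ^ (Nat.log 2 (j : ℕ)))))) ?_ (by positivity) fun j => ?_
  · rw [tsum_eq_sum_head_add _ K, sum_head]
    simp only [log_blockIndex]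
    rw [show (6 * α + 2 * Q ^ 2 + 18) * (2 : ℝ) ^ K =
      (3 + 2 * Q ^ 2 + 3 * (2 * α + 1)) * 2 ^ K + 12 * 2 ^ K by ring,
      ENNReal.ofReal_add (by positivity) (by positivity)]
    refine add_le_add ?_ ?_
    · refine le_trans ?_ (ENNReal.ofReal_le_ofReal
        (sum_two_pow_mul_le (3 + 2 * Q ^ 2) (2 * α + 1) (by positivity) K (by positivity)))
      have hpos : ∀ k ∈ Finset.range K, 0 ≤ (2 * α + 1) * ((K : ℝ) + 1 - k) := by
        intro k hk
        have hk' : (k : ℝ) ≤ K := by exact_mod_cast (Finset.mem_range.1 hk).le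
        exact mul_nonneg (by linarith) (by linarith)
      rw [ENNReal.ofReal_sum_of_nonneg]
      · refine Finset.sum_le_sum fun k hk => ?_
        simp only [if_pos (Finset.mem_range.1 hk)]
        have := hpos k hk
        rw [← ENNReal.ofReal_sum_of_nonneg fun l _ => by positivity]
        refine ENNReal.ofReal_le_ofReal ?_
        rw [Finset.sum_add_distrib, Finset.sum_const, Finset.card_univ, Fintype.card_fin,
          nsmul_eq_mul, ← Finset.mul_sum, ← Finset.sum_mul]
        -- Smoothness of θ₀ matches the variances: the block energy relative to a is at most Q² 2^k.
        have h1 : (∑ l, θ₀ (blockIndex k l) ^ 2) * (2 : ℝ) ^ ((2 * α + 1) * (k : ℝ)) ≤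
            Q ^ 2 * 2 ^ k := by
          refine (mul_le_mul_of_nonneg_right (hθ k) (by positivity)).trans (le_of_eq ?_)
          rw [blockWeight, mul_assoc, ← Real.rpow_add two_pos, ← Real.rpow_natCast 2 k]
          congr 2
          ring
        push_cast
        nlinarith
      · intro k hk
        have := hpos k hk
        positivity
    · calc _ ≤ ∑' i : ℕ, ENNReal.ofReal 4 *
            ENNReal.ofReal (Real.exp (-((2 : ℝ) ^ (i + K) / 2))) := by
            refine ENNReal.tsum_le_tsum fun i => ?_
            simp only [if_neg (show ¬ i + K < K by omega)]
            rw [Finset.sum_const, Finset.card_univ, Fintype.card_fin, ← ENNReal.ofReal_nsmul,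
              nsmul_eq_mul, ← ENNReal.ofReal_mul (by norm_num)]
            refine ENNReal.ofReal_le_ofReal ?_
            push_cast
            set x : ℝ := (2 : ℝ) ^ (i + K)
            have hx : 0 < x := by positivity
            have h7 : x ≤ Real.exp x := by linarith [Real.add_one_le_exp x]
            calc x * (4 * Real.exp (-(4 * x))) ≤ Real.exp x * (4 * Real.exp (-(4 * x))) := by gcongr
              _ = 4 * Real.exp (x + -(4 * x)) := by rw [Real.exp_add]; ring
              _ ≤ _ := by gcongr; linarith
        _ ≤ ENNReal.ofReal 4 * ENNReal.ofReal (3 * Real.exp (-((2 : ℝ) ^ K / 2))) := by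
            rw [ENNReal.tsum_mul_left]
            exact mul_le_mul_right (tsum_exp_neg_two_pow_le K) _
        _ ≤ _ := by
            rw [← ENNReal.ofReal_mul (by norm_num)]
            refine ENNReal.ofReal_le_ofReal ?_
            have : Real.exp (-((2 : ℝ) ^ K / 2)) ≤ 1 := Real.exp_le_one_iff.2 (by linarith)
            linarith
  · set k := Nat.log 2 (j : ℕ) with hkdef
    have hAk := hA k (Set.mem_univ k)
    unfold scaleBox at hAk
    unfold paramBox
    rw [← hkdef]
    split_ifs at hAk ⊢ with hk
    · have hk' : (k : ℝ) ≤ K := by exact_mod_cast hk.le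
      have h0 : 0 ≤ (2 * α + 1) * ((K : ℝ) + 1 - k) := mul_nonneg (by linarith) (by linarith)
      rw [ENNReal.toReal_ofReal (by positivity)]
      exact le_gaussianReal_head hα hk hn hn' _ hAk
    · rw [ENNReal.toReal_ofReal (by positivity), prob_compl_eq_one_sub
        (show MeasurableSet {x : ℝ | sieveRadius α k < |x|} from
          measurableSet_lt measurable_const measurable_id.abs)]
      have hkK : (K : ℝ) ≤ k := by exact_mod_cast not_lt.1 hk
      refine le_trans ?_ (tsub_le_tsub_left (gaussianReal_sieve_compl_le hα (hK.trans hkK) ?_) 1)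
      · set y : ℝ := Real.exp (-(4 * (2 : ℝ) ^ k)) with hy
        have hy0 : 0 < y := Real.exp_pos _
        have hy1 : y ≤ 1 / 4 := by
          have h2k : (1 : ℝ) ≤ 2 ^ k := one_le_pow₀ one_le_two
          rw [hy, Real.exp_neg]
          refine inv_le_of_inv_le₀ (by norm_num) ?_
          have := Real.add_one_le_exp (4 * (2 : ℝ) ^ k)
          norm_num
          linarith
        rw [← ENNReal.ofReal_one, ← ENNReal.ofReal_sub _ (by positivity),
          show 4 * y = 2 * (2 * y) by ring]
        exact ENNReal.ofReal_le_ofReal (exp_neg_two_mul_le (by positivity) (by linarith))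
      · rw [Real.coe_toNNReal _ hAk.1]
        exact hAk.2

/-- The prior mass of a neighbourhood of a parameter in a Besov ball. -/
theorem le_blockPrior_paramBox {α Q : ℝ} (hα : 0 < α) {n K : ℕ} (hK : 2 * α + 5 ≤ K)
    (hn : (2 : ℝ) ^ ((2 * α + 1) * K) ≤ n) (hn' : (n : ℝ) ≤ (2 : ℝ) ^ ((2 * α + 1) * (K + 1)))
    {θ₀ : ℕ+ → ℝ} (hθ : ∀ k, ∑ l, (block θ₀ k l) ^ 2 ≤ Q ^ 2 * blockWeight α k) :
    ENNReal.ofReal (Real.exp (-((8 * α + 2 * Q ^ 2 + 27) * 2 ^ K))) ≤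
      blockPrior (Set.univ.pi (paramBox α n K θ₀)) := by
  have hG : MeasurableSet (Set.univ.pi (scaleBox α K)) :=
    MeasurableSet.univ_pi (measurableSet_scaleBox α K)
  rw [blockPrior_apply (MeasurableSet.univ_pi (measurableSet_paramBox α n K θ₀))]
  calc _ = ENNReal.ofReal (Real.exp (-((6 * α + 2 * Q ^ 2 + 18) * 2 ^ K))) *
        ENNReal.ofReal (Real.exp (-((2 * α + 9) * 2 ^ K))) := by
        rw [← ENNReal.ofReal_mul (Real.exp_pos _).le, ← Real.exp_add]
        congr 2
        ring
    _ ≤ ENNReal.ofReal (Real.exp (-((6 * α + 2 * Q ^ 2 + 18) * 2 ^ K))) *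
        Measure.infinitePi mixLaw (Set.univ.pi (scaleBox α K)) := by
        gcongr
        exact le_infinitePi_mixLaw_scaleBox hα K
    _ = ∫⁻ _ in Set.univ.pi (scaleBox α K),
        ENNReal.ofReal (Real.exp (-((6 * α + 2 * Q ^ 2 + 18) * 2 ^ K)))
          ∂Measure.infinitePi mixLaw := (setLIntegral_const _ _).symm
    _ ≤ ∫⁻ A in Set.univ.pi (scaleBox α K), priorGivenScales A (Set.univ.pi (paramBox α n K θ₀))
          ∂Measure.infinitePi mixLaw :=
        setLIntegral_mono (Kernel.measurable_coe _
          (MeasurableSet.univ_pi (measurableSet_paramBox α n K θ₀)))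
          fun A hA => le_priorGivenScales_paramBox hα hK hn hn' hθ hA
    _ ≤ _ := lintegral_mono' Measure.restrict_le_self le_rfl

end PriorMass

/-! ### Tests, tails and the contraction rate -/

section Contraction

theorem measurableSet_sieve (α : ℝ) (K : ℕ) : MeasurableSet (sieve α K) := by
  simp only [sieve, Set.ofPred_forall]
  exact MeasurableSet.iInter fun i => MeasurableSet.iInter fun l =>
    measurableSet_le (measurable_pi_apply _).abs measurable_const

/-- The constant in the bound of the tail of `θ - θ₀`. -/
noncomputable def tailConst (α Q : ℝ) : ℝ := 2 * (1 + Q ^ 2) * weightSum α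

theorem tailConst_pos {α : ℝ} (hα : 0 < α) (Q : ℝ) : 0 < tailConst α Q :=
  mul_pos (by positivity) (weightSum_pos hα)

theorem tsum_tail_le {α Q : ℝ} (hα : 0 < α) {K : ℕ} {θ θ₀ : ℕ+ → ℝ} (hθ : θ ∈ sieve α K)
    (hθ₀ : ∀ k, ∑ l, (block θ₀ k l) ^ 2 ≤ Q ^ 2 * blockWeight α k) :
    ∑' i, ∑ l : Fin (2 ^ (i + K)),
        ENNReal.ofReal ((θ (blockIndex (i + K) l) - θ₀ (blockIndex (i + K) l)) ^ 2) ≤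
      ENNReal.ofReal (tailConst α Q * blockWeight α K) := by
  rw [tailConst, ← tsum_blockWeight hα (by positivity)]
  refine ENNReal.tsum_le_tsum fun i => ?_
  rw [← ENNReal.ofReal_sum_of_nonneg fun l _ => sq_nonneg _]
  refine ENNReal.ofReal_le_ofReal ?_
  have h1 : ∑ l : Fin (2 ^ (i + K)), θ (blockIndex (i + K) l) ^ 2 ≤ blockWeight α (i + K) := by
    rw [← two_pow_mul_sieveRadius_sq]
    refine (Finset.sum_le_card_nsmul _ _ _ fun l _ =>
      (sq_le_sq' (abs_le.1 (hθ i l)).1 (abs_le.1 (hθ i l)).2)).trans (le_of_eq ?_)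
    rw [Finset.card_univ, Fintype.card_fin, nsmul_eq_mul]
    push_cast
    rfl
  calc _ ≤ ∑ l : Fin (2 ^ (i + K)),
        (2 * θ (blockIndex (i + K) l) ^ 2 + 2 * block θ₀ (i + K) l ^ 2) := by
        refine Finset.sum_le_sum fun l _ => ?_
        rw [block_apply]
        nlinarith [sq_nonneg (θ (blockIndex (i + K) l) + θ₀ (blockIndex (i + K) l))]
    _ ≤ _ := by
        rw [Finset.sum_add_distrib, ← Finset.mul_sum, ← Finset.mul_sum]
        have := hθ₀ (i + K)
        linarith

/-- The balance of bias and variance at level K: n 2^(-2αK) is at most a constant times 2^K. -/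
theorem mul_tail_le {α Q : ℝ} (hα : 0 < α) {n K : ℕ}
    (hn' : (n : ℝ) ≤ (2 : ℝ) ^ ((2 * α + 1) * (K + 1))) (h : ℕ) :
    n * (tailConst α Q * blockWeight α (K + h)) ≤
      (2 : ℝ) ^ (2 * α + 1) * tailConst α Q * 2 ^ K := by
  have hT := tailConst_pos hα Q
  have hw := blockWeight_pos α (K + h)
  have h1 : blockWeight α (K + h) ≤ blockWeight α K := by
    refine Real.rpow_le_rpow_of_exponent_le one_le_two (neg_le_neg ?_)
    push_cast
    gcongr
    linarith [(h.cast_nonneg : (0 : ℝ) ≤ h)]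
  calc n * (tailConst α Q * blockWeight α (K + h))
      ≤ (2 : ℝ) ^ ((2 * α + 1) * (K + 1)) * (tailConst α Q * blockWeight α K) := by gcongr
    _ = tailConst α Q * ((2 : ℝ) ^ ((2 * α + 1) * (K + 1)) * (2 : ℝ) ^ (-(2 * α * K))) := by
        rw [blockWeight]; ring
    _ = tailConst α Q * ((2 : ℝ) ^ (2 * α + 1) * 2 ^ K) := by
        rw [← Real.rpow_natCast 2 K, ← Real.rpow_add two_pos, ← Real.rpow_add two_pos]
        congr 2
        ring
    _ = _ := by ring

theorem paramBox_subset_sieve (α : ℝ) (n K : ℕ) (θ₀ : ℕ+ → ℝ) :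
    Set.univ.pi (paramBox α n K θ₀) ⊆ sieve α K := by
  intro θ hθ i l
  have := hθ (blockIndex (i + K) l) (Set.mem_univ _)
  unfold paramBox at this
  rw [log_blockIndex, if_neg (by omega)] at this
  exact not_lt.1 this

theorem tsum_paramBox_le {α Q : ℝ} (hα : 0 < α) {n K : ℕ} {θ θ₀ : ℕ+ → ℝ}
    (hθ : θ ∈ Set.univ.pi (paramBox α n K θ₀))
    (hθ₀ : ∀ k, ∑ l, (block θ₀ k l) ^ 2 ≤ Q ^ 2 * blockWeight α k) :
    ∑' j, ENNReal.ofReal ((θ j - θ₀ j) ^ 2) ≤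
      ENNReal.ofReal (2 ^ K * (n : ℝ)⁻¹ + tailConst α Q * blockWeight α K) := by
  rw [tsum_eq_sum_head_add _ K, ENNReal.ofReal_add (by positivity)
    (mul_pos (tailConst_pos hα Q) (blockWeight_pos α K)).le]
  refine add_le_add ?_ (tsum_tail_le hα (paramBox_subset_sieve α n K θ₀ hθ) hθ₀)
  rw [← ENNReal.ofReal_sum_of_nonneg fun j _ => sq_nonneg _]
  refine ENNReal.ofReal_le_ofReal ?_
  have h1 : ∀ j ∈ head K, (θ j - θ₀ j) ^ 2 ≤ (n : ℝ)⁻¹ := by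
    intro j hj
    obtain ⟨⟨k, l⟩, hkl, rfl⟩ := Finset.mem_map.1 hj
    have hk : k < K := Finset.mem_range.1 (Finset.mem_sigma.1 hkl).1
    have := hθ (blockIndex k l) (Set.mem_univ _)
    unfold paramBox at this
    rw [log_blockIndex, if_pos hk] at this
    change (θ (blockIndex k l) - θ₀ (blockIndex k l)) ^ 2 ≤ (n : ℝ)⁻¹
    rw [← Real.sq_sqrt (n.cast_nonneg : (0 : ℝ) ≤ n), ← inv_pow]
    exact sq_le_sq' (by linarith [this.1]) (by linarith [this.2])
  refine (Finset.sum_le_card_nsmul _ _ _ h1).trans ?_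
  rw [nsmul_eq_mul]
  gcongr
  exact_mod_cast card_head_le K

theorem seqModel_absolutelyContinuous_zero {α Q : ℝ} (hα : 0 < α) {n : ℕ} (hn : n ≠ 0)
    {θ₀ : ℕ+ → ℝ} (hθ₀ : ∀ k, ∑ l, (block θ₀ k l) ^ 2 ≤ Q ^ 2 * blockWeight α k) :
    seqModel n θ₀ ≪ seqModel n 0 := by
  refine seqModel_absolutelyContinuous hn (c := Q ^ 2 * weightSum α * blockWeight α 0)
    (mul_nonneg (mul_nonneg (sq_nonneg Q) (weightSum_pos hα).le) (blockWeight_pos α 0).le) ?_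
  rw [tsum_eq_tsum_blocks, ← tsum_blockWeight hα (sq_nonneg Q)]
  refine ENNReal.tsum_le_tsum fun k => ?_
  rw [← ENNReal.ofReal_sum_of_nonneg fun l _ => sq_nonneg _]
  refine ENNReal.ofReal_le_ofReal ?_
  simpa [block_apply] using hθ₀ k

/-- The type two error of the test based on the first coordinates. -/
theorem seqModel_acceptance_le {n : ℕ} (hn : n ≠ 0) (K : ℕ) {θ θ₀ : ℕ+ → ℝ} {D : ℝ}
    (h : (8 * D + 12) * 2 ^ K ≤ ∑ j ∈ head K, (n : ℝ) * (θ j - θ₀ j) ^ 2) :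
    seqModel n θ {x | ∑ j ∈ head K, (n : ℝ) * (x j - θ₀ j) ^ 2 < 4 * 2 ^ K} ≤
      ENNReal.ofReal (Real.exp (-(D * 2 ^ K))) := by
  refine (measure_mono ?_).trans ((seqModel_chi_sq_tail hn θ (head K) ((4 * D + 2) * 2 ^ K)).trans
    (ENNReal.ofReal_le_ofReal (Real.exp_le_exp.2 ?_)))
  · intro x hx
    -- If the test accepts, the noise energy is at least half of 8D + 12 minus 4, that is 4D + 2,
    -- times 2^K; the chi-square tail turns this into exp(-D 2^K).
    have h1 : ∑ j ∈ head K, (n : ℝ) * (θ j - θ₀ j) ^ 2 ≤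
        2 * ∑ j ∈ head K, (n : ℝ) * (x j - θ₀ j) ^ 2 +
          2 * ∑ j ∈ head K, (n : ℝ) * (x j - θ j) ^ 2 := by
      rw [Finset.mul_sum, Finset.mul_sum, ← Finset.sum_add_distrib]
      refine Finset.sum_le_sum fun j _ => ?_
      have h2 : (θ j - θ₀ j) ^ 2 ≤ 2 * (x j - θ₀ j) ^ 2 + 2 * (x j - θ j) ^ 2 := by
        nlinarith [sq_nonneg (x j - θ₀ j + (x j - θ j))]
      have := mul_le_mul_of_nonneg_left h2 (n.cast_nonneg : (0 : ℝ) ≤ n)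
      linarith
    simp only [Set.mem_ofPred_eq] at hx ⊢
    linarith
  · have : ((head K).card : ℝ) ≤ 2 ^ K := by exact_mod_cast card_head_le K
    linarith

theorem lt_tsum_of_lt_l2dist {r : ℝ} {θ θ₀ : ℕ+ → ℝ} (hr : 0 ≤ r)
    (h : ENNReal.ofReal r < l2dist θ θ₀) :
    ENNReal.ofReal (r ^ 2) < ∑' j, ENNReal.ofReal ((θ j - θ₀ j) ^ 2) := by
  rw [l2dist, one_div, ENNReal.lt_rpow_inv_iff two_pos] at h
  rw [ENNReal.ofReal_pow hr]
  exact_mod_cast h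

/-- Here nε² = n^(1/(2α+1)) ≥ 2^K, and within the sieve the blocks beyond `head (K + h)` account
only for the subtracted constant. -/
theorem le_sum_head_of_lt_l2dist {α Q : ℝ} (hα : 0 < α) {n K : ℕ}
    (hn : (2 : ℝ) ^ ((2 * α + 1) * K) ≤ n) (hn' : (n : ℝ) ≤ (2 : ℝ) ^ ((2 * α + 1) * (K + 1)))
    (h : ℕ) {θ θ₀ : ℕ+ → ℝ} (hθ : θ ∈ sieve α (K + h))
    (hθ₀ : ∀ k, ∑ l, (block θ₀ k l) ^ 2 ≤ Q ^ 2 * blockWeight α k) {M : ℝ} (hM : 0 ≤ M)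
    (hd : ENNReal.ofReal (M * (n : ℝ) ^ (-(α / (2 * α + 1)))) < l2dist θ θ₀) :
    (M ^ 2 - (2 : ℝ) ^ (2 * α + 1) * tailConst α Q) * 2 ^ K ≤
      ∑ j ∈ head (K + h), (n : ℝ) * (θ j - θ₀ j) ^ 2 := by
  have hn0 : (0 : ℝ) < n := lt_of_lt_of_le (by positivity) hn
  have h1 := (lt_tsum_of_lt_l2dist (by positivity) hd).le
  rw [tsum_eq_sum_head_add _ (K + h), ← ENNReal.ofReal_sum_of_nonneg fun j _ => sq_nonneg _] at h1
  have h2 := h1.trans (add_le_add_right (tsum_tail_le hα hθ hθ₀) _)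
  have hT : 0 ≤ tailConst α Q * blockWeight α (K + h) :=
    (mul_pos (tailConst_pos hα Q) (blockWeight_pos α _)).le
  have hS : 0 ≤ ∑ j ∈ head (K + h), (θ j - θ₀ j) ^ 2 := Finset.sum_nonneg fun j _ => sq_nonneg _
  rw [← ENNReal.ofReal_add hS hT, ENNReal.ofReal_le_ofReal_iff (add_nonneg hS hT)] at h2
  have h3 := mul_le_mul_of_nonneg_left h2 hn0.le
  have h4 : M ^ 2 * 2 ^ K ≤ n * (M * (n : ℝ) ^ (-(α / (2 * α + 1)))) ^ 2 := by
    have h5 : (n : ℝ) * ((n : ℝ) ^ (-(α / (2 * α + 1)))) ^ 2 = (n : ℝ) ^ ((2 * α + 1)⁻¹) := by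
      rw [← Real.rpow_natCast, ← Real.rpow_mul hn0.le]
      nth_rw 1 [← Real.rpow_one (n : ℝ)]
      rw [← Real.rpow_add hn0]
      congr 1
      push_cast
      field_simp
      ring
    have h6 : (2 : ℝ) ^ K ≤ (n : ℝ) ^ ((2 * α + 1)⁻¹) := by
      rw [Real.le_rpow_inv_iff_of_pos (by positivity) hn0.le (by linarith),
        ← Real.rpow_natCast 2 K, ← Real.rpow_mul zero_le_two, mul_comm]
      exact hn
    calc M ^ 2 * 2 ^ K ≤ M ^ 2 * (n : ℝ) ^ ((2 * α + 1)⁻¹) := by gcongr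
      _ = _ := by rw [← h5]; ring
  have h7 := mul_tail_le (Q := Q) hα hn' h
  rw [← Finset.mul_sum]
  linarith

/-- The exponential constant in the prior mass and evidence bounds. -/
noncomputable def evidenceConst (α Q : ℝ) : ℝ :=
  2 * (1 + (2 : ℝ) ^ (2 * α + 1) * tailConst α Q) + (8 * α + 2 * Q ^ 2 + 27)

/-- A nonasymptotic bound of the expected posterior mass outside a ball. -/
theorem lintegral_posteriorProb_le {α Q : ℝ} (hα : 0 < α) {n K h : ℕ} (hK : 2 * α + 5 ≤ K)
    (hn : (2 : ℝ) ^ ((2 * α + 1) * K) ≤ n) (hn' : (n : ℝ) ≤ (2 : ℝ) ^ ((2 * α + 1) * (K + 1)))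
    (hh : 2 * (evidenceConst α Q + 1) ≤ 2 ^ h)
    {θ₀ : ℕ+ → ℝ} (hθ₀ : ∀ k, ∑ l, (block θ₀ k l) ^ 2 ≤ Q ^ 2 * blockWeight α k)
    {M : ℝ} (hM : 0 ≤ M) (hM' : (2 : ℝ) ^ (2 * α + 1) * tailConst α Q +
      (8 * (evidenceConst α Q + 1) + 12) * 2 ^ h ≤ M ^ 2) :
    ∫⁻ x, posteriorProb blockPrior n x
        {θ | ENNReal.ofReal (M * (n : ℝ) ^ (-(α / (2 * α + 1)))) < l2dist θ θ₀} ∂seqModel n θ₀ ≤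
      ENNReal.ofReal (53 * Real.exp (-(2 ^ K / 2))) := by
  have hn0 : (0 : ℝ) < n := lt_of_lt_of_le (by positivity) hn
  have hn1 : n ≠ 0 := by exact_mod_cast hn0.ne'
  have hT := tailConst_pos hα Q
  set N : ℝ := 2 ^ K with hN
  have hN0 : 0 < N := by positivity
  have hKh : (2 : ℝ) ^ (K + h) = 2 ^ h * N := by rw [pow_add, mul_comm]
  set c₁ : ℝ := 1 + (2 : ℝ) ^ (2 * α + 1) * tailConst α Q with hc₁
  set c₂ : ℝ := 8 * α + 2 * Q ^ 2 + 27 with hc₂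
  have hc₁1 : 1 ≤ c₁ := by
    have : 0 < (2 : ℝ) ^ (2 * α + 1) * tailConst α Q := by positivity
    linarith
  have hc₂0 : 0 < c₂ := by positivity
  set c₃ : ℝ := evidenceConst α Q with hc₃
  have hc₃' : c₃ = 2 * c₁ + c₂ := rfl
  set B := Set.univ.pi (paramBox α n K θ₀) with hB
  have hBmass : ENNReal.ofReal (Real.exp (-(c₂ * N))) ≤ blockPrior B :=
    le_blockPrior_paramBox hα hK hn hn' hθ₀
  have hB0 : blockPrior B ≠ 0 := by
    refine (lt_of_lt_of_le ?_ hBmass).ne'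
    exact ENNReal.ofReal_pos.2 (Real.exp_pos _)
  set r : ℝ := 2 ^ K * (n : ℝ)⁻¹ + tailConst α Q * blockWeight α K with hr
  have hr0 : 0 ≤ r := by have := blockWeight_pos α K; positivity
  have hnr : n * r ≤ c₁ * N := by
    have h1 := mul_tail_le (Q := Q) hα hn' 0
    rw [add_zero] at h1
    have h2 : (n : ℝ) * (2 ^ K * (n : ℝ)⁻¹) = N := by rw [hN]; field_simp
    rw [hr, mul_add, h2, hc₁, add_mul, one_mul]
    linarith
  have hdist : ∀ θ ∈ B, ∑' j, ENNReal.ofReal ((θ j - θ₀ j) ^ 2) ≤ ENNReal.ofReal r :=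
    fun θ hθ => tsum_paramBox_le hα hθ hθ₀
  have h0 : seqModel n θ₀ ≪ seqModel n 0 := seqModel_absolutelyContinuous_zero hα hn1 hθ₀
  set E : Set (ℕ+ → ℝ) := {x | ∑ j ∈ head (K + h), (n : ℝ) * (x j - θ₀ j) ^ 2 < 4 * 2 ^ (K + h)}
    with hE
  have hEm : MeasurableSet E := measurableSet_lt (by fun_prop) measurable_const
  set S : Set (ℕ+ → ℝ) :=
    {θ | ENNReal.ofReal (M * (n : ℝ) ^ (-(α / (2 * α + 1)))) < l2dist θ θ₀} with hS
  -- With C = exp(c₁N), the choice t = C² gives C/t = exp(-c₁N), while t divided by the prior mass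
  -- is at most exp((2c₁ + c₂)N) = exp(c₃N).
  have hmain := lintegral_posterior_le (seqModel n) (seqModel n 0) blockPrior h0 hB0
    (fun θ hθ => (seqModel_absolutelyContinuous hn1 hr0 (hdist θ hθ)).trans h0)
    (C := ENNReal.ofReal (Real.exp (c₁ * N))) (fun θ hθ A hA => by
      refine (seqModel_sq_le hn1 (θ' := θ) hr0 ?_ hA).trans ?_
      · refine le_trans (le_of_eq (tsum_congr fun j => ?_)) (hdist θ hθ)
        rw [← neg_sub, neg_sq]
      · gcongr)
    hEm S (t := ENNReal.ofReal (Real.exp (2 * c₁ * N)))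
    (ENNReal.ofReal_pos.2 (Real.exp_pos _)).ne' ENNReal.ofReal_ne_top
  have hb1 : seqModel n θ₀ Eᶜ ≤ ENNReal.ofReal (Real.exp (-(N / 2))) := by
    have h1 : Eᶜ = {x | 4 * 2 ^ (K + h) ≤ ∑ j ∈ head (K + h), (n : ℝ) * (x j - θ₀ j) ^ 2} := by
      ext x; simp [hE]
    rw [h1]
    refine (seqModel_chi_sq_tail hn1 θ₀ _ _).trans
      (ENNReal.ofReal_le_ofReal (Real.exp_le_exp.2 ?_))
    have h2 : ((head (K + h)).card : ℝ) ≤ 2 ^ (K + h) := by exact_mod_cast card_head_le (K + h)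
    have h3 : N ≤ 2 ^ (K + h) := pow_le_pow_right₀ one_le_two (by omega)
    linarith
  have hb2 : 2 * (ENNReal.ofReal (Real.exp (c₁ * N)) / ENNReal.ofReal (Real.exp (2 * c₁ * N))) ≤
      ENNReal.ofReal (2 * Real.exp (-(N / 2))) := by
    rw [← ENNReal.ofReal_div_of_pos (Real.exp_pos _), ← Real.exp_sub,
      ENNReal.ofReal_mul zero_le_two, ENNReal.ofReal_ofNat]
    gcongr
    nlinarith
  have hb3 : ∫⁻ θ in S, seqModel n θ E ∂blockPrior ≤
      ENNReal.ofReal (25 * Real.exp (-((c₃ + 1) * N))) := by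
    -- Off the sieve the test is useless and the prior probability is used; on it the test has
    -- power. Both must beat exp(c₃N), hence the exponent c₃ + 1.
    have h1 : ∀ θ ∈ S, seqModel n θ E ≤ (sieve α (K + h))ᶜ.indicator 1 θ +
        ENNReal.ofReal (Real.exp (-((c₃ + 1) * N))) := by
      intro θ hθ
      by_cases hF : θ ∈ sieve α (K + h)
      · refine le_trans ?_ le_add_self
        refine (seqModel_acceptance_le (D := c₃ + 1) hn1 (K + h) ?_).trans
          (ENNReal.ofReal_le_ofReal (Real.exp_le_exp.2 (neg_le_neg ?_)))
        · refine le_trans ?_ (le_sum_head_of_lt_l2dist hα hn hn' h hF hθ₀ hM hθ)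
          rw [hKh, ← mul_assoc]
          gcongr
          linarith
        · have : N ≤ 2 ^ (K + h) := pow_le_pow_right₀ one_le_two (by omega)
          gcongr
          linarith
      · rw [Set.indicator_of_mem (show θ ∈ (sieve α (K + h))ᶜ from hF)]
        exact prob_le_one.trans le_self_add
    have hFm : MeasurableSet (sieve α (K + h))ᶜ := (measurableSet_sieve α (K + h)).compl
    calc _ ≤ ∫⁻ θ in S, (sieve α (K + h))ᶜ.indicator 1 θ +
          ENNReal.ofReal (Real.exp (-((c₃ + 1) * N))) ∂blockPrior :=
          setLIntegral_mono ((measurable_one.indicator hFm).add measurable_const) h1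
      _ ≤ ∫⁻ θ, (sieve α (K + h))ᶜ.indicator 1 θ +
          ENNReal.ofReal (Real.exp (-((c₃ + 1) * N))) ∂blockPrior :=
          lintegral_mono' Measure.restrict_le_self le_rfl
      _ = blockPrior (sieve α (K + h))ᶜ + ENNReal.ofReal (Real.exp (-((c₃ + 1) * N))) := by
          rw [lintegral_add_right _ measurable_const, lintegral_indicator_one hFm,
            lintegral_const, measure_univ, mul_one]
      _ ≤ ENNReal.ofReal (24 * Real.exp (-((c₃ + 1) * N))) +
          ENNReal.ofReal (Real.exp (-((c₃ + 1) * N))) := by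
          gcongr
          refine (blockPrior_sieve_compl_le hα ?_).trans (ENNReal.ofReal_le_ofReal ?_)
          · push_cast
            linarith [(h.cast_nonneg : (0 : ℝ) ≤ h)]
          · gcongr
            rw [hKh]
            nlinarith
      _ = _ := by
          rw [← ENNReal.ofReal_add (by positivity) (by positivity)]
          congr 1
          ring
  have hb4 : 2 * ENNReal.ofReal (Real.exp (2 * c₁ * N)) / blockPrior B ≤
      ENNReal.ofReal (2 * Real.exp (c₃ * N)) := by
    calc _ ≤ 2 * ENNReal.ofReal (Real.exp (2 * c₁ * N)) /
          ENNReal.ofReal (Real.exp (-(c₂ * N))) := by gcongr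
      _ = _ := by
        rw [mul_div_assoc, ← ENNReal.ofReal_div_of_pos (Real.exp_pos _), ← Real.exp_sub,
          ENNReal.ofReal_mul zero_le_two, ENNReal.ofReal_ofNat, hc₃']
        congr 3
        ring
  refine hmain.trans ?_
  calc _ ≤ ENNReal.ofReal (Real.exp (-(N / 2))) + ENNReal.ofReal (2 * Real.exp (-(N / 2))) +
        ENNReal.ofReal (2 * Real.exp (c₃ * N)) *
          ENNReal.ofReal (25 * Real.exp (-((c₃ + 1) * N))) :=
        add_le_add (add_le_add hb1 hb2) (mul_le_mul' hb4 hb3)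
    _ = ENNReal.ofReal (3 * Real.exp (-(N / 2)) + 50 * Real.exp (-N)) := by
        rw [← ENNReal.ofReal_mul (by positivity), ← ENNReal.ofReal_add (by positivity)
          (by positivity), ← ENNReal.ofReal_add (by positivity) (by positivity)]
        have h1 : Real.exp (c₃ * N) * Real.exp (-((c₃ + 1) * N)) = Real.exp (-N) := by
          rw [← Real.exp_add]
          congr 1
          ring
        rw [← h1]
        congr 1
        ring
    _ ≤ _ := by
        refine ENNReal.ofReal_le_ofReal ?_
        have : Real.exp (-N) ≤ Real.exp (-(N / 2)) := Real.exp_le_exp.2 (by linarith)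
        linarith

/-- The critical resolution level at sample size `n`. -/
noncomputable def criticalLevel (α : ℝ) (n : ℕ) : ℕ := ⌊Real.logb 2 n / (2 * α + 1)⌋₊

theorem tendsto_criticalLevel {α : ℝ} (hα : 0 < α) : Tendsto (criticalLevel α) atTop atTop :=
  tendsto_nat_floor_atTop.comp (((Real.tendsto_logb_atTop one_lt_two).comp
    tendsto_natCast_atTop_atTop).atTop_div_const (by linarith))

theorem rpow_criticalLevel_le {α : ℝ} (hα : 0 < α) {n : ℕ} (hn : n ≠ 0) :
    (2 : ℝ) ^ ((2 * α + 1) * criticalLevel α n) ≤ n := by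
  have hn1 : (1 : ℝ) ≤ n := by exact_mod_cast Nat.one_le_iff_ne_zero.2 hn
  rw [← Real.le_logb_iff_rpow_le one_lt_two (by linarith), mul_comm,
    ← le_div_iff₀ (by linarith)]
  exact Nat.floor_le (div_nonneg (Real.logb_nonneg one_lt_two hn1) (by linarith))

theorem le_rpow_criticalLevel {α : ℝ} (hα : 0 < α) {n : ℕ} (hn : n ≠ 0) :
    (n : ℝ) ≤ (2 : ℝ) ^ ((2 * α + 1) * (criticalLevel α n + 1)) := by
  have hn0 : (0 : ℝ) < n := by exact_mod_cast Nat.pos_of_ne_zero hn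
  rw [← Real.logb_le_iff_le_rpow one_lt_two hn0, mul_comm, ← div_le_iff₀ (by linarith)]
  exact (Nat.lt_floor_add_one _).le

end Contraction

end BlockPrior

theorem theorem5p3 (α : ℝ) (p q : ℝ≥0∞) (Q : ℝ) (hα : 0 < α) (hp : 2 ≤ p) (hq : 1 ≤ q)
    (hQ : 0 < Q) :
    ∃ M : ℝ, 0 < M ∧
      Tendsto
        (fun n : ℕ =>
          ⨆ θ₀ ∈ BlockPrior.besovBall α p q Q,
            ∫⁻ x, BlockPrior.posteriorProb BlockPrior.blockPrior n x
                {θ | ENNReal.ofReal (M * (n : ℝ) ^ (-(α / (2 * α + 1))))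
                  < BlockPrior.l2dist θ θ₀}
              ∂(BlockPrior.seqModel n θ₀))
        atTop (𝓝 0) := by
  -- The shift h makes the sieve complement smaller than exp(-(c₃+1)N). It depends on α and Q only,
  -- so it affects M but not the rate.
  obtain ⟨h, hh⟩ := pow_unbounded_of_one_lt (2 * (BlockPrior.evidenceConst α Q + 1))
    (one_lt_two (α := ℝ))
  set m : ℝ := (2 : ℝ) ^ (2 * α + 1) * BlockPrior.tailConst α Q +
    (8 * (BlockPrior.evidenceConst α Q + 1) + 12) * 2 ^ h with hm
  have hm0 : 0 < m := by
    have := BlockPrior.tailConst_pos hα Q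
    have h1 : 0 < BlockPrior.evidenceConst α Q := by unfold BlockPrior.evidenceConst; positivity
    positivity
  refine ⟨Real.sqrt m, Real.sqrt_pos.2 hm0, ?_⟩
  have hlim : Tendsto (fun n : ℕ => ENNReal.ofReal
      (53 * Real.exp (-((2 : ℝ) ^ BlockPrior.criticalLevel α n / 2)))) atTop (𝓝 0) := by
    rw [← ENNReal.ofReal_zero]
    refine ENNReal.tendsto_ofReal ?_
    rw [← mul_zero (53 : ℝ)]
    refine Tendsto.const_mul 53 (Real.tendsto_exp_neg_atTop_nhds_zero.comp ?_)
    exact ((tendsto_pow_atTop_atTop_of_one_lt one_lt_two).comp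
      (BlockPrior.tendsto_criticalLevel hα)).atTop_div_const two_pos
  refine tendsto_of_tendsto_of_tendsto_of_le_of_le' tendsto_const_nhds hlim
    (Eventually.of_forall fun n => zero_le) ?_
  filter_upwards [eventually_ne_atTop 0, (tendsto_natCast_atTop_atTop.comp
    (BlockPrior.tendsto_criticalLevel hα)).eventually_ge_atTop (2 * α + 5)] with n hn hK
  refine iSup₂_le fun θ₀ hθ₀ => ?_
  exact BlockPrior.lintegral_posteriorProb_le hα hK (BlockPrior.rpow_criticalLevel_le hα hn)
    (BlockPrior.le_rpow_criticalLevel hα hn) hh.le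
    (BlockPrior.sum_block_sq_le hp hq hQ hθ₀) (Real.sqrt_nonneg _)
    (by rw [Real.sq_sqrt hm0.le])
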